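/- **Setting.** Let $T\in\mathbb N$, $d\ge 1$, $\alpha\in(1,2]$, and let $L$ be a $d$-dimensional strictly $\alpha$-stable Lévy process. If $\alpha<2$, its Lévy measure is $f\mapsto\int_0^\infty\int_{\mathbb S^d}\frac{c}{w^{\alpha+1}}f(wv)\,\tilde\sigma(\mathrm dv)\,\mathrm dw$ with $c>0$ and a probability measure $\tilde\sigma$ on the unit sphere $\mathbb S^d$ of $\mathbb R^d$. If $\alpha=2$, $L$ is a Brownian motion with positive definite correlation matrix $R$ (and standard components). Either (A) $L$ is symmetric, or (B) $d=1$ and only non-negative controls are allowed. Let $\mu,\sigma$ be continuous and deterministic on $[0,T]$ with values in $\mathbb R^d$ and in the symmetric positive definite $d\times d$ matrices with positive entries, $r\in\mathbb R$, $M>0$, $\lambda:[0,T]\to(0,\infty)$ continuous, $\mathcal T\in C^1$ non-decreasing and concave, $F\in C^1$ non-decreasing and convex, and $\mathbb E|\mathcal T(a+\langle b,L_t\rangle)|<\infty$ for all $a\in\mathbb R$, $b\in\mathbb R^d$, $t\in(0,T]$. A control law $u=(u_k)_k$ consists of Borel functions $u_k:\mathbb R\to\mathbb R^d$ with values in $U=[-M,M]^d$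 (in case (B): $U=[0,M]$); $u_k(y)$ is the vector of amounts held in the risky assets over $(k,k+1]$ when the wealth at time $k$ is $y$. Let $\mathcal U$ be the set of control laws and $\tilde{\mathcal U}$ the set of deterministic ones (each $u_k$ constant). For $u\in\tilde{\mathcal U}$ write $u_s=u_k$ if $s\in(k,k+1]$. The wealth $X^u$ solves $\mathrm dX^u_t=[rX^u_t+u_t^T(\mu_t-r)]\,\mathrm dt+u_t^T\sigma_t\,\mathrm dL_t$; $\mathbb E_{n,x}$ and $\rho_{n,x}$ refer to the law of the wealth started at time $n$ in $X_n=x$. Let $\rho$ be a law-invariant, positively homogeneous risk measure with values in $\mathbb R\cup\{+\infty\}$ which is cash-invariant ($\rho(Y+a)=\rho(Y)-a$) or shift-invariant ($\rho(Y+a)=\rho(Y)$), defined on a convex set of random variables that contains $\mathcal L^\alpha(\mathcal F_T)$, where $\mathcal F_T=\sigma(L_s:s\le T)$, and is stable under multiplication by non-negative constants and addition of constants. It is regarded as a functional of laws. Put $\hat L=\tilde L$ if $\alpha<2$ and (A) is in force, where $\tilde L$ is the symmetric one-dimensional $\alpha$-stable Lévy process with the same constant $c$, and let $\hat L=L^1$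 otherwise. Assume $\varrho^{\hat L_1}:=\rho(\hat L_1)\in\mathbb R$. Define $m_s(u)=u_s^T(\mu_s-r)e^{r(T-s)}$ if $\rho$ is cash-invariant, $m_s(u)=0$ if $\rho$ is shift-invariant, and $${}^\alpha w_s(u)=\begin{cases}\|u_s^T\sigma_s v\,e^{r(T-s)}\|_{\mathcal L^\alpha(\mathbb S^d,\tilde\sigma(\mathrm dv))}&\alpha<2,\ \text{(A)}\\ u^1_s\sigma^{11}_se^{r(T-s)}&\alpha<2,\ \text{(B)}\\ \sqrt{u_s^T\sigma_sR\,\sigma_s^Tu_s}\;e^{r(T-s)}&\alpha=2.\end{cases}$$ For a control law $u$ set $$G^u_n(x)=\mathbb E_{n,x}\big[\mathcal T(X^u_T-xe^{r(T-n)})\big],\quad H^u_n(x)=\lambda_nF\big(\rho_{n,x}(X^u_T-xe^{r(T-n)})\big),\quad J_n(x,u)=G^u_n(x)-H^u_n(x),$$ and $(\mathrm A^uf)_n(x)=\mathbb E_{n,x}[f_{n+1}(X^u_{n+1})-f_n(x)]$. For control laws $\hat u,u$ and a time $n$ let $\bar u=\bar u^{(n)}$ be the law with $\bar u_n=u_n$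 and $\bar u_k=\hat u_k$ for $k\ne n$. The law $\hat u$ is an equilibrium control law if $\sup_{u\in\mathcal U}J_n(x,\bar u)=J_n(x,\hat u)$ for all $n\in\{0,\dots,T-1\}$ and $x\in\mathbb R$; its equilibrium value function is $V_n(x)=J_n(x,\hat u)$. **Theorem.** Let $\hat u\in\tilde{\mathcal U}$ be an equilibrium control law with equilibrium value function $V$. For all $u\in\tilde{\mathcal U}$, $n\in\{0,\dots,T\}$ and $x\in\mathbb R$, $G^u_n(x)$ is the expectation of an integrable random variable and $\rho_{n,x}(X^u_T-xe^{r(T-n)})$ is finite; all expectations below exist. For all $n\in\{0,\dots,T-1\}$ and $x\in\mathbb R$, $$\sup_{u\in\tilde{\mathcal U}}\Big\{(\mathrm A^{\bar u}V)_n(x)-(\mathrm A^{\bar u}G^{\bar u})_n(x)+(\mathrm A^{\bar u}H^{\bar u})_n(x)\Big\}=0,$$ and the supremum is attained at $u=\hat u$; moreover $V_T(x)=\mathcal T(0)-\lambda_TF(0)$. Furthermore, for $n\in\{0,\dots,T-1\}$ and $x\in\mathbb R$, $$(\mathrm A^{\hat u}G^{\hat u})_n(x)=\mathbb E_{n,x}\Big[\mathcal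 T\big(X_T^{\hat u}-X^{\hat u}_{n+1}e^{r(T-n-1)}\big)-\mathcal T\big(X_T^{\hat u}-xe^{r(T-n)}\big)\Big],$$ and, with $\Phi_n:=F\big(-\int_n^Tm_s(\hat u)\,\mathrm ds+\varrho^{\hat L_1}\,\|{}^\alpha w_s(\hat u)\|_{\mathcal L^\alpha((n,T],\mathrm ds)}\big)$, $$(\mathrm A^{\hat u}H^{\hat u})_n(x)=\lambda_{n+1}\big[\Phi_{n+1}-\Phi_n\big]-(\lambda_n-\lambda_{n+1})\,\Phi_n,\qquad H^{\hat u}_T(x)=\lambda_TF(0).$$ -/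

import Mathlib

open MeasureTheory ProbabilityTheory Filter Topology Set
open scoped NNReal ENNReal RealInnerProductSpace

namespace MeanRisk

/-- `ℝ^d` with the Euclidean norm. -/
abbrev Vec (d : ℕ) : Type := EuclideanSpace ℝ (Fin d)

/-- The unit sphere of `ℝ^d`. -/
abbrev USphere (d : ℕ) : Type := Metric.sphere (0 : Vec d) 1

section Levy

/-- The Lévy measure `f ↦ ∫_{w > 0} ∫_{sphere} f (w v) c / w ^ (α + 1) σ̃(dv) dw`. -/
noncomputable def levyMeasure {d : ℕ} (α c : ℝ) (spec : Measure (USphere d)) : Measure (Vec d) :=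
  (spec.prod ((volume.restrict (Ioi (0 : ℝ))).withDensity
    (fun w => ENNReal.ofReal (c / w ^ (α + 1))))).map (fun p => p.2 • (p.1 : Vec d))

/-- The characteristic exponent of a strictly `α`-stable Lévy process, `α ∈ (1, 2]`.
For `α < 2` this is the Lévy-Khintchine integral of the `α`-stable Lévy measure (for `α ∈ (1, 2)`
strict stability forces the process to be centred, hence the full compensation);
for `α = 2` it is the exponent of a `d`-dimensional Brownian motion with correlation matrix `R`. -/
noncomputable def stableExponent {d : ℕ} (α c : ℝ) (spec : Measure (USphere d))
    (R : Matrix (Fin d) (Fin d) ℝ) (y : Vec d) : ℂ :=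
  if α < 2 then
    ∫ x, (Complex.exp ((⟪x, y⟫ : ℝ) * Complex.I) - 1 - (⟪x, y⟫ : ℝ) * Complex.I)
      ∂(levyMeasure α c spec)
  else ((-(dotProduct y.ofLp (R.mulVec y.ofLp)) / 2 : ℝ) : ℂ)

variable {Ω : Type*} [MeasurableSpace Ω]

/-- `L` is an `α`-stable Lévy process: càdlàg, started at `0`, independent and stationary
increments, and `E exp(i⟨y, L_t⟩) = exp(t ψ(y))` with the exponent `ψ` above (the Lévy measure is
given by `c` and `spec` if `α < 2`; `L` is a Brownian motion with correlation matrix `R` if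
`α = 2`). The filtration is the one generated by `L`. -/
structure IsStableLevy {d : ℕ} (P : Measure Ω) (α c : ℝ) (spec : Measure (USphere d))
    (R : Matrix (Fin d) (Fin d) ℝ) (L : ℝ≥0 → Ω → Vec d) : Prop where
  measurable : ∀ t, Measurable (L t)
  zero : ∀ᵐ ω ∂P, L 0 ω = 0
  cadlag : ∀ᵐ ω ∂P, ∀ t, ContinuousWithinAt (fun s => L s ω) (Ici t) t ∧
    ∃ l, Tendsto (fun s => L s ω) (𝓝[<] t) (𝓝 l)
  indep : HasIndepIncrements L P
  stationary : ∀ s t, IdentDistrib (fun ω => L (s + t) ω - L s ω) (L t) P P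
  charFun_eq : ∀ t y, charFun (P.map (L t)) y =
    Complex.exp (((t : ℝ) : ℂ) * stableExponent α c spec R y)

/-- Symmetry of a Lévy process, `L = -L` in law. -/
def IsSymmetric {d : ℕ} (P : Measure Ω) (L : ℝ≥0 → Ω → Vec d) : Prop :=
  ∀ t, IdentDistrib (L t) (fun ω => -L t ω) P P

/-- The `σ`-algebra generated by `(L_s)_{s ≤ T}`. -/
abbrev pastSigma {d : ℕ} (L : ℝ≥0 → Ω → Vec d) (T : ℝ≥0) : MeasurableSpace Ω :=
  ⨆ s : {s : ℝ≥0 // s ≤ T}, MeasurableSpace.comap (L s.1) inferInstance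

/-- The integral `∫_{a+}^t H^K_s dL_s` of the left-point discretization `H^K` of `H` along the
equidistant partition of `[a, b]` into `K` intervals. -/
noncomputable def riemannSum {d : ℕ} (L : ℝ≥0 → Ω → Vec d) (H : ℝ → Ω → Vec d) (a b : ℝ) (K : ℕ)
    (t : ℝ) (ω : Ω) : ℝ :=
  ∑ k ∈ Finset.range K, ⟪H (a + k * ((b - a) / K)) ω,
    L (min (a + (k + 1) * ((b - a) / K)) t).toNNReal ω
      - L (min (a + k * ((b - a) / K)) t).toNNReal ω⟫

/-- `I t = ∫_{a+}^t ⟨H_s, dL_s⟩` for `t ∈ [a, b]`, for an adapted left-continuous integrand `H`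
with right limits: `I` is the limit, uniformly on `[a, b]` in probability (ucp), of the integrals
of the discretizations of `H`. -/
def IsStochIntegral {d : ℕ} (P : Measure Ω) (L : ℝ≥0 → Ω → Vec d) (H : ℝ → Ω → Vec d) (a b : ℝ)
    (I : ℝ → Ω → ℝ) : Prop :=
  ∀ ε : ℝ, 0 < ε → Tendsto
    (fun K : ℕ => P {ω | ∃ t ∈ Icc a b, ε ≤ |riemannSum L H a b K t ω - I t ω|}) atTop (𝓝 0)

end Levy

section Risk

/-- A law-invariant, positively homogeneous risk measure which is cash-invariant or
shift-invariant, with values in `ℝ ∪ {+∞}`, on a convex set `carrier` of random variables which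
contains all `α`-integrable ones that are measurable with respect to `(L_s)_{s ≤ T}`, and is stable under the two operations that
occur in the axioms. -/
structure RiskMeasure {d : ℕ} {Ω : Type*} [MeasurableSpace Ω] (P : Measure Ω)
    (L : ℝ≥0 → Ω → Vec d) (T : ℝ≥0) (α : ℝ) where
  carrier : Set (Ω → ℝ)
  val : (Ω → ℝ) → EReal
  measurable_of_mem : ∀ Y ∈ carrier, Measurable Y
  mem_of_memLp : ∀ Y : Ω → ℝ, Measurable[pastSigma L T] Y → MemLp Y (ENNReal.ofReal α) P → Y ∈ carrier
  convex : Convex ℝ carrier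
  smul_mem : ∀ Y ∈ carrier, ∀ β : ℝ, 0 ≤ β → (fun ω => β * Y ω) ∈ carrier
  add_const_mem : ∀ Y ∈ carrier, ∀ a : ℝ, (fun ω => Y ω + a) ∈ carrier
  ne_bot : ∀ Y ∈ carrier, val Y ≠ ⊥
  law_invariant : ∀ Y₁ ∈ carrier, ∀ Y₂ ∈ carrier, IdentDistrib Y₁ Y₂ P P → val Y₁ = val Y₂
  pos_homogeneous : ∀ Y ∈ carrier, ∀ β : ℝ, 0 ≤ β →
    val (fun ω => β * Y ω) = (β : EReal) * val Y
  cash_or_shift :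
    (∀ Y ∈ carrier, ∀ a : ℝ, val (fun ω => Y ω + a) = val Y - (a : EReal)) ∨
    (∀ Y ∈ carrier, ∀ a : ℝ, val (fun ω => Y ω + a) = val Y)

variable {d : ℕ} {Ω : Type*} [MeasurableSpace Ω] {P : Measure Ω} {L : ℝ≥0 → Ω → Vec d}
  {T : ℝ≥0} {α : ℝ}

/-- Cash-invariance. It excludes shift-invariance, since `0 ∈ carrier` has the finite risk `0`. -/
def RiskMeasure.CashInvariant (ρ : RiskMeasure P L T α) : Prop :=
  ∀ Y ∈ ρ.carrier, ∀ a : ℝ, ρ.val (fun ω => Y ω + a) = ρ.val Y - (a : EReal)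

/-- The risk measure as a functional of the law: the common value of `ρ` at all `Y ∈ carrier`
with law `ν` (and `+∞` if there is no such `Y`). -/
noncomputable def RiskMeasure.ofLaw (ρ : RiskMeasure P L T α) (ν : Measure ℝ) : EReal :=
  ⨅ Y ∈ {Y : Ω → ℝ | Y ∈ ρ.carrier ∧ P.map Y = ν}, ρ.val Y

end Risk

/-- The two alternative settings: a symmetric driving process with controls in `[-M, M]^d`, or
one risky asset (`d = 1`) without short selling, i.e. controls in `[0, M]`. -/
inductive Setting where
  | symmetric
  | longOnly

/-- The deterministic data of the market and of the investor in discrete time with step size `1`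
and horizon `T`. -/
structure Market (d : ℕ) where
  setting : Setting
  /-- horizon -/
  T : ℕ
  /-- stability index -/
  α : ℝ
  /-- constant and spherical part of the Lévy measure, only relevant for `α < 2` -/
  c : ℝ
  spec : Measure (USphere d)
  /-- correlation matrix, only relevant for `α = 2`; it is constant in time because the
  increments of the driving process are stationary -/
  R : Matrix (Fin d) (Fin d) ℝ
  /-- short rate -/
  r : ℝ
  /-- bound on the controls -/
  M : ℝ
  /-- drift and volatility -/
  μ : ℝ → Vec d
  σ : ℝ → Matrix (Fin d) (Fin d) ℝ
  /-- risk aversion, reward function and risk penalization -/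
  lam : ℝ → ℝ
  rew : ℝ → ℝ
  F : ℝ → ℝ
  α_gt : 1 < α
  α_le : α ≤ 2
  c_pos : 0 < c
  spec_prob : IsProbabilityMeasure spec
  R_corr : α = 2 → R.PosDef ∧ ∀ i, R i i = 1
  M_pos : 0 < M
  μ_cont : ContinuousOn μ (Icc 0 (T : ℝ))
  σ_cont : ContinuousOn σ (Icc 0 (T : ℝ))
  σ_pos : ∀ t ∈ Icc 0 (T : ℝ), ∀ i j, 0 < σ t i j
  /-- includes the symmetry of `σ t` -/
  σ_posDef : ∀ t ∈ Icc 0 (T : ℝ), (σ t).PosDef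
  lam_cont : ContinuousOn lam (Icc 0 (T : ℝ))
  lam_pos : ∀ t ∈ Icc 0 (T : ℝ), 0 < lam t
  rew_smooth : ContDiff ℝ 1 rew
  rew_mono : Monotone rew
  rew_concave : ConcaveOn ℝ univ rew
  F_smooth : ContDiff ℝ 1 F
  F_mono : Monotone F
  F_convex : ConvexOn ℝ univ F

/-- A control law in feedback form: at the decision time `k` and in the state `y` the amounts
`u k y` are invested over the period `(k, k + 1]`. -/
abbrev ControlLaw (d : ℕ) : Type := ℕ → ℝ → Vec d

/-- A deterministic control law. -/
def det {d : ℕ} (v : ℕ → Vec d) : ControlLaw d := fun k _ => v k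

/-- The left-continuous step function with value `v k` on `(k, k + 1]`. -/
noncomputable def step {d : ℕ} (v : ℕ → Vec d) (s : ℝ) : Vec d := v (⌈s⌉₊ - 1)

/-- The law which follows `u` at time `n` and `û` at all other times. -/
def deviate {d : ℕ} (û u : ControlLaw d) (n : ℕ) : ControlLaw d := Function.update û n (u n)

namespace Market

variable {d : ℕ} (K : Market d)

/-- The admissible control values. -/
def controlSet : Set (Vec d) :=
  match K.setting with
  | .symmetric => {v | ∀ i, |v i| ≤ K.M}
  | .longOnly => {v | ∀ i, 0 ≤ v i ∧ v i ≤ K.M}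

/-- The admissible control laws. -/
def admissible : Set (ControlLaw d) :=
  {u | ∀ k, Measurable (u k) ∧ ∀ y, u k y ∈ K.controlSet}

/-- The deterministic piecewise constant admissible controls. -/
def detAdmissible : Set (ℕ → Vec d) := {v | ∀ k, v k ∈ K.controlSet}

variable {Ω : Type*} [MeasurableSpace Ω]

/-- The assumption on the driving process in the respective setting. -/
def SettingHolds (P : Measure Ω) (L : ℝ≥0 → Ω → Vec d) : Prop :=
  match K.setting with
  | .symmetric => IsSymmetric P L
  | .longOnly => d = 1

/-- The row vector `uᵀ σ_s`. -/
noncomputable def exposure (u : Vec d) (s : ℝ) : Vec d :=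
  WithLp.toLp 2 (Matrix.vecMul u.ofLp (K.σ s))

/-- The excess return rate `uᵀ (μ_s - r)`. -/
noncomputable def excess (u : Vec d) (s : ℝ) : ℝ := ∑ i, u i * (K.μ s i - K.r)

/-- The control process of the feedback law `u` along `X`, for a start at time `n`. -/
noncomputable def controlPath (n : ℕ) (u : ControlLaw d) (X : ℝ → Ω → ℝ) (s : ℝ) (ω : Ω) :
    Vec d :=
  u (max n (⌈s⌉₊ - 1)) (X ((max n (⌈s⌉₊ - 1) : ℕ) : ℝ) ω)

/-- `X` is the wealth process on `[n, T]` with `X_n = x` under the control law `u`: a càdlàg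
solution of `dX = [r X + uᵀ (μ - r)] dt + uᵀ σ dL`. (A solution is unique and adapted up to null
sets, since the equation determines it successively on the periods `(k, k + 1]`.) -/
structure IsWealth (P : Measure Ω) (L : ℝ≥0 → Ω → Vec d) (n : ℕ) (x : ℝ) (u : ControlLaw d)
    (X : ℝ → Ω → ℝ) : Prop where
  measurable : ∀ t ∈ Icc (n : ℝ) K.T, Measurable (X t)
  cadlag : ∀ᵐ ω ∂P, ∀ t ∈ Icc (n : ℝ) K.T,
    ContinuousWithinAt (fun s => X s ω) (Icc t K.T) t ∧
    ∃ l, Tendsto (fun s => X s ω) (𝓝[Ico (n : ℝ) t] t) (𝓝 l)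
  sde : ∃ I : ℝ → Ω → ℝ,
    IsStochIntegral P L (fun s ω => K.exposure (controlPath n u X s ω) s) n K.T I ∧
    ∀ᵐ ω ∂P, ∀ t ∈ Icc (n : ℝ) K.T,
      X t ω = x + (∫ s in (n : ℝ)..t, (K.r * X s ω + K.excess (controlPath n u X s ω) s)) + I t ω

/-! Below, `X n x u` is the wealth process started at time `n` in `x` under the control law `u`;
the conditional expectation `E_{n,x}` of a functional of the wealth from time `n` on is the
expectation of that functional of `X n x u`. -/

/-- The gain `X_T - x e^{r (T - n)}` of the wealth started at `(n, x)`. -/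
noncomputable def gain (X : ℕ → ℝ → ControlLaw d → ℝ → Ω → ℝ) (u : ControlLaw d) (n : ℕ) (x : ℝ)
    (ω : Ω) : ℝ :=
  X n x u K.T ω - x * Real.exp (K.r * (K.T - n))

/-- `E_{n,x}[𝒯(X_T^u - x e^{r (T - n)})]`. -/
noncomputable def rewardFn (P : Measure Ω) (X : ℕ → ℝ → ControlLaw d → ℝ → Ω → ℝ)
    (u : ControlLaw d) (n : ℕ) (x : ℝ) : ℝ :=
  ∫ ω, K.rew (K.gain X u n x ω) ∂P

/-- `ρ_{n,x}(X_T^u - x e^{r (T - n)})`. -/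
noncomputable def riskVal {P : Measure Ω} {L : ℝ≥0 → Ω → Vec d} (ρ : RiskMeasure P L K.T K.α)
    (X : ℕ → ℝ → ControlLaw d → ℝ → Ω → ℝ) (u : ControlLaw d) (n : ℕ) (x : ℝ) : EReal :=
  ρ.ofLaw (P.map (K.gain X u n x))

/-- `λ_n F(ρ_{n,x}(X_T^u - x e^{r (T - n)}))`. -/
noncomputable def riskFn {P : Measure Ω} {L : ℝ≥0 → Ω → Vec d} (ρ : RiskMeasure P L K.T K.α)
    (X : ℕ → ℝ → ControlLaw d → ℝ → Ω → ℝ) (u : ControlLaw d) (n : ℕ) (x : ℝ) : ℝ :=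
  K.lam n * K.F (K.riskVal ρ X u n x).toReal

/-- The value functional `J_n(x, u)`. -/
noncomputable def J {P : Measure Ω} {L : ℝ≥0 → Ω → Vec d} (ρ : RiskMeasure P L K.T K.α)
    (X : ℕ → ℝ → ControlLaw d → ℝ → Ω → ℝ) (u : ControlLaw d) (n : ℕ) (x : ℝ) : ℝ :=
  K.rewardFn P X u n x - K.riskFn ρ X u n x

/-- `û` is a perfect subgame Nash equilibrium. The equilibrium value function is then
`V_n(x) = J_n(x, û)`. -/
def IsEquilibrium {P : Measure Ω} {L : ℝ≥0 → Ω → Vec d} (ρ : RiskMeasure P L K.T K.α)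
    (X : ℕ → ℝ → ControlLaw d → ℝ → Ω → ℝ) (û : ControlLaw d) : Prop :=
  û ∈ K.admissible ∧ ∀ n < K.T, ∀ x,
    IsLUB ((fun u => K.J ρ X (deviate û u n) n x) '' K.admissible) (K.J ρ X û n x)

/-- `m_s(u)`. -/
noncomputable def m {P : Measure Ω} {L : ℝ≥0 → Ω → Vec d} (ρ : RiskMeasure P L K.T K.α)
    (v : ℕ → Vec d) (s : ℝ) : ℝ :=
  open scoped Classical in
  if ρ.CashInvariant then K.excess (step v s) s * Real.exp (K.r * (K.T - s)) else 0

/-- `w_s(u)`. -/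
noncomputable def w [NeZero d] (v : ℕ → Vec d) (s : ℝ) : ℝ :=
  if K.α < 2 then
    match K.setting with
    | .symmetric =>
        lpNorm (fun y : USphere d =>
            dotProduct (K.exposure (step v s) s).ofLp (y : Vec d).ofLp
              * Real.exp (K.r * (K.T - s)))
          (ENNReal.ofReal K.α) K.spec
    | .longOnly => step v s 0 * K.σ s 0 0 * Real.exp (K.r * (K.T - s))
  else
    √(dotProduct (K.exposure (step v s) s).ofLp (K.R.mulVec (K.exposure (step v s) s).ofLp))
      * Real.exp (K.r * (K.T - s))

/-- The law of `L̂_1`: `L̂` is the symmetric one-dimensional process `Ls` if `α < 2` and the setting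
is the symmetric one, and the first component of `L` otherwise. -/
noncomputable def lhatLaw [NeZero d] {Ω' : Type*} [MeasurableSpace Ω'] (P : Measure Ω)
    (L : ℝ≥0 → Ω → Vec d) (P' : Measure Ω') (Ls : ℝ≥0 → Ω' → Vec 1) : Measure ℝ :=
  if K.α < 2 then
    match K.setting with
    | .symmetric => P'.map (fun ω => Ls 1 ω 0)
    | .longOnly => P.map (fun ω => L 1 ω 0)
  else P.map (fun ω => L 1 ω 0)

/-- `-∫_n^T m_s(u) ds + ϱ ‖w(u)‖_{L^α((n, T])}`. -/
noncomputable def riskFormula [NeZero d] {P : Measure Ω} {L : ℝ≥0 → Ω → Vec d}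
    (ρ : RiskMeasure P L K.T K.α) (ϱ : ℝ) (v : ℕ → Vec d) (n : ℕ) : ℝ :=
  -(∫ s in (n : ℝ)..K.T, K.m ρ v s)
    + ϱ * lpNorm (K.w v) (ENNReal.ofReal K.α) (volume.restrict (Ioc (n : ℝ) K.T))

end Market

section Generator

variable {d : ℕ} {Ω : Type*} [MeasurableSpace Ω]

/-- The discrete-time generator `(A^u f)_n(x) = E_{n,x}[f_{n+1}(X_{n+1}^u) - f_n(x)]`. -/
noncomputable def generator (P : Measure Ω) (X : ℕ → ℝ → ControlLaw d → ℝ → Ω → ℝ)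
    (u : ControlLaw d) (f : ℕ → ℝ → ℝ) (n : ℕ) (x : ℝ) : ℝ :=
  ∫ ω, (f (n + 1) (X n x u ((n + 1 : ℕ) : ℝ) ω) - f n x) ∂P

/-- The expectation that defines `(A^u f)_n(x)` exists. -/
def GeneratorExists (P : Measure Ω) (X : ℕ → ℝ → ControlLaw d → ℝ → Ω → ℝ)
    (u : ControlLaw d) (f : ℕ → ℝ → ℝ) (n : ℕ) (x : ℝ) : Prop :=
  Integrable (fun ω => f (n + 1) (X n x u ((n + 1 : ℕ) : ℝ) ω) - f n x) P

/-- The expression under the supremum in the extended HJB equation at `(n, x)`, where `V` is the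
equilibrium value function of `û` and `u` the control law in use. -/
noncomputable def hjbTerm (K : Market d) {P : Measure Ω} {L : ℝ≥0 → Ω → Vec d}
    (ρ : RiskMeasure P L K.T K.α) (X : ℕ → ℝ → ControlLaw d → ℝ → Ω → ℝ) (û u : ControlLaw d)
    (n : ℕ) (x : ℝ) : ℝ :=
  generator P X u (K.J ρ X û) n x - generator P X u (K.rewardFn P X u) n x
    + generator P X u (K.riskFn ρ X u) n x

end Generator

end MeanRisk

/-!
Under a deterministic control `v` the wealth equation is linear with deterministic coefficients, so
variation of constants gives
`X_T - e^{r (T - m)} X_m = ∫_m^T e^{r (T - s)} v_sᵀ (μ_s - r) ds + ∫_m^T e^{r (T - s)} v_sᵀ σ_s dL_s`.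
The law of the right-hand side does not depend on `X_m`. Its characteristic function is
`exp (iξ a + ∫_m^T ψ (ξ e^{r (T - s)} σ_sᵀ v_s) ds)`, where `a` is the drift integral and `ψ` the
exponent of `L`. In each setting `ψ (ξ h) = Q h * κ ξ` along the exposures `h` that occur, where `κ`
is the exponent of `L̂_1` and is homogeneous of degree `α`, and `Q h ^ (1 / α)` is the integrand `w`
of the risk formula (`exists_isFactorization`). Hence the gain has the law of `W L̂_1 + a` with `W`
the `L^α` norm of `w` (`map_gain`). Law invariance, positive homogeneity and cash- or
shift-invariance turn this into the formula for the risk of the gain (`ofLaw_gainLaw`). Rewards are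
integrable because `W L̂_1` also has the law of a linear functional of `L_1`
(`IsFactorization.integrable_rew`).

As a consequence, the reward and risk terms of a deterministic control are constant in the wealth,
and at time `n + 1` they ignore the control at time `n`. The expression in the extended HJB
equation therefore reduces to `J_n(x, ū) - J_n(x, û)`, which is at most zero by the equilibrium
property and vanishes for `u = û`.

The stochastic integral is only given as a limit in probability, uniform in time, of integrals of
discretizations. No integration theory is needed: the discounted integral is, along a càdlàg path
`I`, the limit of the sums `∑ e^{r (T - s_j)} (I_{s_{j+1}} - I_{s_j})` (`gridSum`), and by summation
by parts these sums are Lipschitz in the uniform norm of `I`, uniformly in the grid. So `I` may be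
replaced by its discretization, whose sums are weighted sums of independent increments of `L`
(`Market.IsWealth.charFun_gain`).
-/

namespace MeanRisk

section Paths

/-! ### Càdlàg paths and discounted sums over grids -/

/-- `f` is càdlàg on `[a, b]`. The value at `a` is not constrained by a left limit, since
`𝓝[Ico a a] a` is the trivial filter. -/
def CadlagOn (f : ℝ → ℝ) (a b : ℝ) : Prop :=
  ∀ t ∈ Icc a b, ContinuousWithinAt f (Icc t b) t ∧ ∃ l, Tendsto f (𝓝[Ico a t] t) (𝓝 l)

lemma CadlagOn.exists_bound {f : ℝ → ℝ} {a b : ℝ} (hf : CadlagOn f a b) :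
    ∃ C, ∀ t ∈ Icc a b, |f t| ≤ C := by
  have key : ∃ C, ∀ t ∈ Icc a b, t ∈ Icc a b → |f t| ≤ C := by
    refine isCompact_Icc.induction_on (p := fun s => ∃ C, ∀ t ∈ s, t ∈ Icc a b → |f t| ≤ C)
      ⟨0, by simp⟩ ?_ ?_ ?_
    · rintro s t hst ⟨C, hC⟩
      exact ⟨C, fun u hu => hC u (hst hu)⟩
    · rintro s t ⟨C, hC⟩ ⟨C', hC'⟩
      refine ⟨max C C', fun u hu hu' => ?_⟩
      rcases hu with hu | hu
      · exact (hC u hu hu').trans (le_max_left _ _)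
      · exact (hC' u hu hu').trans (le_max_right _ _)
    · intro t ht
      obtain ⟨h1, l, h2⟩ := hf t ht
      have e1 : ∀ᶠ s in 𝓝[Icc t b] t, |f s| ≤ |f t| + 1 :=
        (h1.tendsto.abs.eventually (eventually_le_nhds (lt_add_one _)))
      have e2 : ∀ᶠ s in 𝓝[Ico a t] t, |f s| ≤ |l| + 1 :=
        (h2.abs.eventually (eventually_le_nhds (lt_add_one _)))
      have hU : Icc a b = Icc t b ∪ Ico a t := by
        ext s; simp only [mem_Icc, mem_union, mem_Ico] at ht ⊢
        constructor
        · intro hs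
          rcases lt_or_ge s t with h | h
          · exact Or.inr ⟨hs.1, h⟩
          · exact Or.inl ⟨h, hs.2⟩
        · rintro (hs | hs)
          · exact ⟨ht.1.trans hs.1, hs.2⟩
          · exact ⟨hs.1, hs.2.le.trans ht.2⟩
      have e3 : ∀ᶠ s in 𝓝[Icc a b] t, |f s| ≤ max (|f t| + 1) (|l| + 1) := by
        rw [hU, nhdsWithin_union]
        refine eventually_sup.2 ⟨?_, ?_⟩
        · filter_upwards [e1] with s hs using hs.trans (le_max_left _ _)
        · filter_upwards [e2] with s hs using hs.trans (le_max_right _ _)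
      exact ⟨{s | |f s| ≤ max (|f t| + 1) (|l| + 1)}, e3, _, fun s hs _ => hs⟩
  obtain ⟨C, hC⟩ := key
  exact ⟨C, fun t ht => hC t ht ht⟩

lemma CadlagOn.mono_left {f : ℝ → ℝ} {a a' b : ℝ} (hf : CadlagOn f a b) (h : a ≤ a') :
    CadlagOn f a' b := by
  intro t ht
  obtain ⟨h1, l, h2⟩ := hf t ⟨h.trans ht.1, ht.2⟩
  exact ⟨h1, l, h2.mono_left (nhdsWithin_mono _ (Ico_subset_Ico_left h))⟩

lemma CadlagOn.sub_continuousOn {f g : ℝ → ℝ} {a b : ℝ} (hf : CadlagOn f a b)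
    (hg : ContinuousOn g (Icc a b)) : CadlagOn (fun t => f t - g t) a b := by
  intro t ht
  obtain ⟨h1, l, h2⟩ := hf t ht
  refine ⟨h1.sub ((hg t ht).mono (Icc_subset_Icc_left ht.1)), l - g t, h2.sub ?_⟩
  exact (hg t ht).mono_left (nhdsWithin_mono _
    (fun s hs => ⟨hs.1, hs.2.le.trans ht.2⟩))

lemma CadlagOn.congr {f g : ℝ → ℝ} {a b : ℝ} (hf : CadlagOn f a b)
    (hg : ∀ t ∈ Icc a b, g t = f t) : CadlagOn g a b := by
  intro t ht
  obtain ⟨h1, l, h2⟩ := hf t ht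
  refine ⟨h1.congr (fun s hs => hg s ⟨ht.1.trans hs.1, hs.2⟩) (hg t ht), l, ?_⟩
  refine h2.congr' ?_
  filter_upwards [self_mem_nhdsWithin] with s hs
  exact (hg s ⟨hs.1, hs.2.le.trans ht.2⟩).symm

/-- The index of the interval of the grid `m + j / N` that contains `s`: `s` lies in
`(m + (gridIdx m N s - 1) / N, m + gridIdx m N s / N]` for `s > m`. -/
noncomputable def gridIdx (m : ℝ) (N : ℕ) (s : ℝ) : ℕ := ⌈(s - m) * N⌉₊

lemma measurable_gridIdx (m : ℝ) (N : ℕ) : Measurable (gridIdx m N) :=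
  Nat.measurable_ceil.comp (by fun_prop)

lemma gridIdx_eq {m : ℝ} {N : ℕ} (hN : 0 < N) {j : ℕ} {s : ℝ}
    (hs : s ∈ Ioc (m + j / N) (m + (j + 1) / N)) : gridIdx m N s = j + 1 := by
  have hN' : (0 : ℝ) < N := by exact_mod_cast hN
  rw [gridIdx, Nat.ceil_eq_iff (by omega)]
  obtain ⟨h1, h2⟩ := hs
  have h1' : (j : ℝ) / N < s - m := by linarith
  have h2' : s - m ≤ (j + 1) / N := by linarith
  rw [div_lt_iff₀ hN'] at h1'
  rw [le_div_iff₀ hN'] at h2'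
  constructor
  · simpa using h1'
  · push_cast; linarith

/-- Sums over the grid as integrals of step functions. -/
lemma sum_integral_grid {m : ℝ} {N : ℕ} (hN : 0 < N) (M : ℕ) {k : ℝ → ℝ} (hk : Continuous k)
    (φ : ℕ → ℝ) :
    ∑ j ∈ Finset.range M, (∫ s in (m + j / N)..(m + (j + 1) / N), k s) * φ j
      = ∫ s in m..(m + M / N), k s * φ (gridIdx m N s - 1) := by
  have hN' : (0 : ℝ) < N := by exact_mod_cast hN
  have hle : ∀ j : ℕ, m + (j : ℝ) / N ≤ m + ((j : ℝ) + 1) / N := fun j => by gcongr; linarith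
  have hcongr : ∀ j : ℕ, ∀ s ∈ Ioc (m + (j : ℝ) / N) (m + ((j : ℝ) + 1) / N),
      k s * φ (gridIdx m N s - 1) = k s * φ j := by
    intro j s hs
    rw [gridIdx_eq hN hs, Nat.add_sub_cancel]
  have hint : ∀ j < M, IntervalIntegrable (fun s => k s * φ (gridIdx m N s - 1)) volume
      (m + (j : ℝ) / N) (m + ((j + 1 : ℕ) : ℝ) / N) := by
    intro j _
    push_cast
    have : IntervalIntegrable (fun s => k s * φ j) volume
      (m + (j : ℝ) / N) (m + ((j : ℝ) + 1) / N) :=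
      (hk.mul continuous_const).intervalIntegrable _ _
    refine this.congr ?_
    intro s hs
    rw [uIoc_of_le (hle j)] at hs
    exact (hcongr j s hs).symm
  have := intervalIntegral.sum_integral_adjacent_intervals
    (a := fun j : ℕ => m + (j : ℝ) / N) hint
  simp only [Nat.cast_zero, zero_div, add_zero] at this
  rw [← this]
  refine Finset.sum_congr rfl fun j _ => ?_
  push_cast
  rw [← intervalIntegral.integral_mul_const]
  refine intervalIntegral.integral_congr_ae (Eventually.of_forall fun s hs => ?_)
  rw [uIoc_of_le (hle j)] at hs
  exact (hcongr j s hs).symm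

/-- The right end point of the grid interval that contains `s`. -/
noncomputable def gridUp (m : ℝ) (N : ℕ) (s : ℝ) : ℝ := m + gridIdx m N s / N

/-- The left end point of the grid interval that contains `s`. -/
noncomputable def gridDn (m : ℝ) (N : ℕ) (s : ℝ) : ℝ := m + ((gridIdx m N s - 1 : ℕ) : ℝ) / N

lemma le_gridUp {m : ℝ} {N : ℕ} (hN : 0 < N) (s : ℝ) : s ≤ gridUp m N s := by
  have hN' : (0 : ℝ) < N := by exact_mod_cast hN
  have := Nat.le_ceil ((s - m) * N)
  have : s - m ≤ gridIdx m N s / N := by rw [le_div_iff₀ hN']; exact this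
  unfold gridUp; linarith

lemma gridUp_lt {m : ℝ} {N : ℕ} (hN : 0 < N) {s : ℝ} (hs : m ≤ s) :
    gridUp m N s < s + 1 / N := by
  have hN' : (0 : ℝ) < N := by exact_mod_cast hN
  have h1 := Nat.ceil_lt_add_one (a := (s - m) * N) (mul_nonneg (by linarith) hN'.le)
  have : (gridIdx m N s : ℝ) / N < (s - m) + 1 / N := by
    rw [div_lt_iff₀ hN', add_mul, one_div, inv_mul_cancel₀ hN'.ne']; exact h1
  unfold gridUp; linarith

lemma gridUp_le {m T N : ℕ} (hmT : m ≤ T) (hN : 0 < N) {s : ℝ} (hs : s ≤ T) :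
    gridUp m N s ≤ T := by
  have hN' : (0 : ℝ) < N := by exact_mod_cast hN
  have : gridIdx m N s ≤ (T - m) * N := by
    refine Nat.ceil_le.2 ?_
    push_cast [Nat.cast_sub hmT]
    gcongr
  have h2 : (gridIdx m N s : ℝ) / N ≤ (T : ℝ) - m := by
    rw [div_le_iff₀ hN', ← Nat.cast_sub hmT]
    exact_mod_cast this
  unfold gridUp; linarith

lemma gridDn_eq {m : ℝ} {N : ℕ} (hN : 0 < N) {s : ℝ} (hs : m < s) :
    gridDn m N s = gridUp m N s - 1 / N := by
  have hN' : (0 : ℝ) < N := by exact_mod_cast hN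
  have : 0 < gridIdx m N s := Nat.ceil_pos.2 (mul_pos (by linarith) hN')
  unfold gridDn gridUp
  rw [Nat.cast_sub (by omega)]
  push_cast
  ring

lemma le_gridDn {m : ℝ} {N : ℕ} (s : ℝ) : m ≤ gridDn m N s := by
  unfold gridDn
  have : (0 : ℝ) ≤ ((gridIdx m N s - 1 : ℕ) : ℝ) / N := by positivity
  linarith

lemma tendsto_gridUp {m s : ℝ} (hs : m ≤ s) : Tendsto (fun N => gridUp m N s) atTop (𝓝 s) := by
  have h : Tendsto (fun N : ℕ => s + 1 / (N : ℝ)) atTop (𝓝 s) := by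
    simpa using (tendsto_const_nhds (x := s)).add tendsto_one_div_atTop_nhds_zero_nat
  refine tendsto_of_tendsto_of_tendsto_of_le_of_le' tendsto_const_nhds h ?_ ?_
  · filter_upwards [eventually_gt_atTop 0] with N hN using le_gridUp hN s
  · filter_upwards [eventually_gt_atTop 0] with N hN using (gridUp_lt hN hs).le

lemma tendsto_gridDn {m s : ℝ} (hs : m < s) : Tendsto (fun N => gridDn m N s) atTop (𝓝 s) := by
  have h : Tendsto (fun N : ℕ => gridUp m N s - 1 / (N : ℝ)) atTop (𝓝 s) := by
    simpa using (tendsto_gridUp hs.le).sub tendsto_one_div_atTop_nhds_zero_nat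
  refine h.congr' ?_
  filter_upwards [eventually_gt_atTop 0] with N hN using (gridDn_eq hN hs).symm

/-- Right-point approximations of the integral of a càdlàg function. -/
lemma CadlagOn.tendsto_integral_gridUp {f : ℝ → ℝ} {m T : ℕ} (hmT : m ≤ T)
    (hf : CadlagOn f m T) {k : ℝ → ℝ} (hk : Continuous k) :
    Tendsto (fun N => ∫ s in (m : ℝ)..T, k s * f (gridUp m N s)) atTop
      (𝓝 (∫ s in (m : ℝ)..T, k s * f s)) := by
  have hmT' : (m : ℝ) ≤ T := by exact_mod_cast hmT
  obtain ⟨C, hC⟩ := hf.exists_bound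
  refine intervalIntegral.tendsto_integral_filter_of_dominated_convergence
    (fun s => |k s| * C) ?_ ?_ ?_ ?_
  · refine Eventually.of_forall fun N => ?_
    refine (hk.measurable.mul ?_).aestronglyMeasurable
    exact (measurable_from_nat (f := fun j : ℕ => f ((m : ℝ) + j / N))).comp
      (measurable_gridIdx m N)
  · filter_upwards [eventually_gt_atTop 0] with N hN
    refine Eventually.of_forall fun s hs => ?_
    rw [uIoc_of_le hmT'] at hs
    rw [norm_mul, Real.norm_eq_abs, Real.norm_eq_abs]
    gcongr
    exact hC _ ⟨hs.1.le.trans (le_gridUp hN s), gridUp_le hmT hN hs.2⟩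
  · exact (hk.abs.mul continuous_const).intervalIntegrable _ _
  · refine Eventually.of_forall fun s hs => ?_
    rw [uIoc_of_le hmT'] at hs
    refine tendsto_const_nhds.mul ?_
    refine (hf s ⟨hs.1.le, hs.2⟩).1.tendsto.comp ?_
    refine tendsto_nhdsWithin_iff.2 ⟨tendsto_gridUp hs.1.le, ?_⟩
    filter_upwards [eventually_gt_atTop 0] with N hN
    exact ⟨le_gridUp hN s, gridUp_le hmT hN hs.2⟩

/-- A càdlàg function is bounded, and measurable as the pointwise limit of step functions. -/
lemma CadlagOn.intervalIntegrable {f : ℝ → ℝ} {m T : ℕ} (hmT : m ≤ T)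
    (hf : CadlagOn f m T) : IntervalIntegrable f volume m T := by
  have hmT' : (m : ℝ) ≤ T := by exact_mod_cast hmT
  obtain ⟨C, hC⟩ := hf.exists_bound
  rw [intervalIntegrable_iff_integrableOn_Ioc_of_le hmT']
  have hmeas : AEStronglyMeasurable f (volume.restrict (Ioc (m : ℝ) T)) := by
    refine aestronglyMeasurable_of_tendsto_ae atTop (f := fun N s => f (gridUp m N s)) ?_ ?_
    · intro N
      exact ((measurable_from_nat (f := fun j : ℕ => f ((m : ℝ) + j / N))).comp
        (measurable_gridIdx m N)).aestronglyMeasurable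
    · filter_upwards [ae_restrict_mem measurableSet_Ioc] with s hs
      refine (hf s ⟨hs.1.le, hs.2⟩).1.tendsto.comp ?_
      refine tendsto_nhdsWithin_iff.2 ⟨tendsto_gridUp hs.1.le, ?_⟩
      filter_upwards [eventually_gt_atTop 0] with N hN
      exact ⟨le_gridUp hN s, gridUp_le hmT hN hs.2⟩
  refine Integrable.of_bound hmeas C ?_
  filter_upwards [ae_restrict_mem measurableSet_Ioc] with s hs
  exact hC s ⟨hs.1.le, hs.2⟩

/-- Left-point approximations of the integral of an almost everywhere continuous function. -/
lemma tendsto_integral_gridDn {q : ℝ → ℝ} {m T : ℕ} (hmT : m ≤ T) {C : ℝ}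
    (hC : ∀ s ∈ Icc (m : ℝ) T, |q s| ≤ C)
    (hq : ∀ᵐ s, s ∈ Ioc (m : ℝ) T → ContinuousWithinAt q (Icc m s) s) :
    Tendsto (fun N => ∫ s in (m : ℝ)..T, q (gridDn m N s)) atTop
      (𝓝 (∫ s in (m : ℝ)..T, q s)) := by
  have hmT' : (m : ℝ) ≤ T := by exact_mod_cast hmT
  have hup : ∀ {N : ℕ} {s : ℝ}, 0 < N → s ∈ Ioc (m : ℝ) T → gridDn m N s ≤ s := by
    intro N s hN hs
    rw [gridDn_eq hN hs.1]
    linarith [gridUp_lt hN hs.1.le]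
  refine intervalIntegral.tendsto_integral_filter_of_dominated_convergence
    (fun _ => C) ?_ ?_ ?_ ?_
  · refine Eventually.of_forall fun N => ?_
    exact ((measurable_from_nat (f := fun j : ℕ => q ((m : ℝ) + ((j - 1 : ℕ) : ℝ) / N))).comp
      (measurable_gridIdx m N)).aestronglyMeasurable
  · filter_upwards [eventually_gt_atTop 0] with N hN
    refine Eventually.of_forall fun s hs => ?_
    rw [uIoc_of_le hmT'] at hs
    exact hC _ ⟨le_gridDn s, (hup hN hs).trans hs.2⟩
  · simp
  · filter_upwards [hq] with s hqs hs
    rw [uIoc_of_le hmT'] at hs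
    refine (hqs hs).tendsto.comp ?_
    refine tendsto_nhdsWithin_iff.2 ⟨tendsto_gridDn hs.1, ?_⟩
    filter_upwards [eventually_gt_atTop 0] with N hN
    exact ⟨le_gridDn s, hup hN hs⟩

/-- The discounted sum `∑ e^{r (T - s_j)} (f s_{j+1} - f s_j)` over the grid `s_j = m + j / N`
of `[m, T]`. -/
noncomputable def gridSum (r : ℝ) (m T N : ℕ) (f : ℝ → ℝ) : ℝ :=
  ∑ j ∈ Finset.range ((T - m) * N),
    Real.exp (r * (T - (m + j / N))) * (f (m + (j + 1) / N) - f (m + j / N))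

/-- Summation by parts; the discount increments are written as integrals, so that the grid enters
only through the points at which `f` is evaluated. -/
lemma gridSum_eq {m T N : ℕ} (hmT : m ≤ T) (hN : 0 < N) (r : ℝ) (f : ℝ → ℝ) :
    gridSum r m T N f = f T - Real.exp (r * (T - m)) * f m
      + ∫ s in (m : ℝ)..T, r * Real.exp (r * (T - s)) * f (gridUp m N s) := by
  have hN' : (0 : ℝ) < N := by exact_mod_cast hN
  have hmT' : (m : ℝ) ≤ T := by exact_mod_cast hmT
  have hend : (m : ℝ) + (((T - m) * N : ℕ) : ℝ) / N = T := by
    push_cast [Nat.cast_sub hmT]; field_simp; ring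
  have hI : ∀ a b : ℝ, ∫ s in a..b, r * Real.exp (r * (T - s))
      = Real.exp (r * (T - a)) - Real.exp (r * (T - b)) := by
    intro a b
    have hd : ∀ s ∈ uIcc a b, HasDerivAt (fun s => -Real.exp (r * (T - s)))
        (r * Real.exp (r * (T - s))) s := by
      intro s _
      have h1 : HasDerivAt (fun s : ℝ => r * ((T : ℝ) - s)) (r * (0 - 1)) s :=
        ((hasDerivAt_const s (T : ℝ)).sub (hasDerivAt_id s)).const_mul r
      convert! h1.exp.neg using 1
      ring
    rw [intervalIntegral.integral_eq_sub_of_hasDerivAt hd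
      ((by fun_prop : Continuous fun s : ℝ => r * Real.exp (r * (T - s))).intervalIntegrable _ _)]
    ring
  have h1 := sum_integral_grid (m := (m : ℝ)) hN ((T - m) * N)
    (k := fun s => r * Real.exp (r * (T - s))) (by fun_prop)
    (fun j => f (m + (j + 1) / N))
  rw [hend] at h1
  have h2 : ∫ s in (m : ℝ)..T, r * Real.exp (r * (T - s)) * f (gridUp m N s)
      = ∫ s in (m : ℝ)..T, r * Real.exp (r * (T - s)) *
          f (m + (((gridIdx m N s - 1 : ℕ) : ℝ) + 1) / N) := by
    refine intervalIntegral.integral_congr_ae (Eventually.of_forall fun s hs => ?_)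
    rw [uIoc_of_le hmT'] at hs
    have : 0 < gridIdx m N s := Nat.ceil_pos.2 (mul_pos (by linarith [hs.1]) hN')
    rw [Nat.cast_sub (by omega)]
    simp [gridUp]
  rw [h2, ← h1]
  have h3 : f T - Real.exp (r * (T - m)) * f m
      = ∑ j ∈ Finset.range ((T - m) * N),
        (Real.exp (r * (T - (m + ((j + 1 : ℕ) : ℝ) / N))) * f (m + ((j + 1 : ℕ) : ℝ) / N)
          - Real.exp (r * (T - (m + (j : ℝ) / N))) * f (m + (j : ℝ) / N)) := by
    rw [Finset.sum_range_sub
      (fun j : ℕ => Real.exp (r * (T - (m + (j : ℝ) / N))) * f (m + (j : ℝ) / N)), hend]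
    simp
  rw [h3, ← Finset.sum_add_distrib, gridSum]
  refine Finset.sum_congr rfl fun j _ => ?_
  rw [hI]
  push_cast
  ring

lemma CadlagOn.tendsto_gridSum {f : ℝ → ℝ} {m T : ℕ} (hmT : m ≤ T) (hf : CadlagOn f m T)
    (r : ℝ) :
    Tendsto (fun N => gridSum r m T N f) atTop
      (𝓝 (f T - Real.exp (r * (T - m)) * f m
        + ∫ s in (m : ℝ)..T, r * Real.exp (r * (T - s)) * f s)) := by
  have h := (tendsto_const_nhds (x := f T - Real.exp (r * (T - m)) * f m)).add
    (hf.tendsto_integral_gridUp hmT (k := fun s => r * Real.exp (r * (T - s))) (by fun_prop))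
  refine h.congr' ?_
  filter_upwards [eventually_gt_atTop 0] with N hN using (gridSum_eq hmT hN r f).symm

/-- The discounted sum over the grid is continuous in the uniform norm, uniformly in the grid. -/
lemma exists_gridSum_bound {m T : ℕ} (hmT : m ≤ T) (r : ℝ) :
    ∃ C, 0 < C ∧ ∀ N : ℕ, 0 < N → ∀ (f : ℝ → ℝ) (δ : ℝ), (∀ t ∈ Icc (m : ℝ) T, |f t| ≤ δ) →
      |gridSum r m T N f| ≤ C * δ := by
  have hmT' : (m : ℝ) ≤ T := by exact_mod_cast hmT
  obtain ⟨B, hB⟩ := (isCompact_Icc (a := (m : ℝ)) (b := T)).exists_bound_of_continuousOn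
    (f := fun s => r * Real.exp (r * (T - s))) (by fun_prop)
  have hB0 : 0 ≤ B := (norm_nonneg _).trans (hB m ⟨le_rfl, hmT'⟩)
  refine ⟨1 + Real.exp (r * (T - m)) + B * (T - m), ?_, fun N hN f δ hδ => ?_⟩
  · have := Real.exp_pos (r * (T - m))
    have : 0 ≤ B * ((T : ℝ) - m) := mul_nonneg hB0 (by linarith)
    linarith
  · have hδ0 : 0 ≤ δ := (abs_nonneg _).trans (hδ m ⟨le_rfl, hmT'⟩)
    have h1 : ‖∫ s in (m : ℝ)..T, r * Real.exp (r * (T - s)) * f (gridUp m N s)‖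
        ≤ B * δ * |(T : ℝ) - m| := by
      refine intervalIntegral.norm_integral_le_of_norm_le_const fun s hs => ?_
      rw [uIoc_of_le hmT'] at hs
      rw [norm_mul]
      gcongr
      · exact hB s ⟨hs.1.le, hs.2⟩
      · exact hδ _ ⟨hs.1.le.trans (le_gridUp hN s), gridUp_le hmT hN hs.2⟩
    rw [abs_of_nonneg (sub_nonneg.2 hmT'), Real.norm_eq_abs] at h1
    have h2 : |f T| ≤ δ := hδ T ⟨hmT', le_rfl⟩
    have h3 : |Real.exp (r * (T - m)) * f m| ≤ Real.exp (r * (T - m)) * δ := by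
      rw [abs_mul, abs_of_pos (Real.exp_pos _)]
      gcongr
      exact hδ m ⟨le_rfl, hmT'⟩
    rw [gridSum_eq hmT hN]
    calc _ ≤ |f T| + |Real.exp (r * (T - m)) * f m|
          + |∫ s in (m : ℝ)..T, r * Real.exp (r * (T - s)) * f (gridUp m N s)| :=
          (abs_add_le _ _).trans (by gcongr; exact abs_sub _ _)
      _ ≤ δ + Real.exp (r * (T - m)) * δ + B * δ * (T - m) := by gcongr
      _ = _ := by ring

/-- Variation of constants for a linear equation with a càdlàg driver `I`. The right-hand side is
the limit of `gridSum` along `I`. -/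
lemma linear_solution {X b I : ℝ → ℝ} {x r : ℝ} {n m T : ℕ} (hnm : n ≤ m) (hmT : m ≤ T)
    (hX : CadlagOn X n T) (hb : IntervalIntegrable b volume n T)
    (hsol : ∀ t ∈ Icc (n : ℝ) T, X t = x + (∫ s in (n : ℝ)..t, (r * X s + b s)) + I t) :
    CadlagOn I n T ∧
    X T - Real.exp (r * (T - m)) * X m = (∫ s in (m : ℝ)..T, Real.exp (r * (T - s)) * b s)
      + (I T - Real.exp (r * (T - m)) * I m
        + ∫ s in (m : ℝ)..T, r * Real.exp (r * (T - s)) * I s) := by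
  have hnm' : (n : ℝ) ≤ m := by exact_mod_cast hnm
  have hmT' : (m : ℝ) ≤ T := by exact_mod_cast hmT
  have hnT' : (n : ℝ) ≤ T := hnm'.trans hmT'
  have hg : IntervalIntegrable (fun s => r * X s + b s) volume n T :=
    ((hX.intervalIntegrable (hnm.trans hmT)).const_mul r).add hb
  set Y : ℝ → ℝ := fun t => ∫ s in (n : ℝ)..t, (r * X s + b s) with hY
  have hYac : AbsolutelyContinuousOnInterval Y n T :=
    hg.absolutelyContinuousOnInterval_intervalIntegral (by simp)
  have hYc : ContinuousOn Y (Icc n T) := by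
    have := hYac.continuousOn
    rwa [uIcc_of_le hnT'] at this
  have hI : ∀ t ∈ Icc (n : ℝ) T, I t = X t - (x + Y t) := by
    intro t ht
    rw [hsol t ht]; ring
  have hIc : CadlagOn I n T :=
    (hX.sub_continuousOn (g := fun t => x + Y t) (continuousOn_const.add hYc)).congr hI
  refine ⟨hIc, ?_⟩
  set e : ℝ → ℝ := fun s => Real.exp (r * (T - s)) with he
  have hed : ∀ s, HasDerivAt e (-(r * e s)) s := by
    intro s
    have h1 : HasDerivAt (fun s : ℝ => r * ((T : ℝ) - s)) (r * (0 - 1)) s :=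
      ((hasDerivAt_const s (T : ℝ)).sub (hasDerivAt_id s)).const_mul r
    convert! h1.exp using 1
    simp only [he]
    ring
  have hec : Continuous e := by fun_prop
  have heac : AbsolutelyContinuousOnInterval e m T := by
    refine ContDiffOn.absolutelyContinuousOnInterval ?_
    have : ContDiff ℝ 1 e := by fun_prop
    exact this.contDiffOn
  have hsub : uIcc (m : ℝ) T ⊆ uIcc (n : ℝ) T := by
    rw [uIcc_of_le hmT', uIcc_of_le hnT']; exact Icc_subset_Icc_left hnm'
  -- `X` may jump, but `Y` is absolutely continuous, so integration by parts applies to it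
  have hibp := heac.integral_mul_deriv_eq_deriv_mul (hYac.mono hsub)
  have hd1 : ∫ s in (m : ℝ)..T, e s * deriv Y s = ∫ s in (m : ℝ)..T, e s * (r * X s + b s) := by
    refine intervalIntegral.integral_congr_ae ?_
    filter_upwards [hg.ae_hasDerivAt_integral] with s hs hs'
    have hs'' : s ∈ uIcc (n : ℝ) T := hsub (uIoc_subset_uIcc hs')
    rw [(hs hs'' n (by simp)).deriv]
  have hd2 : ∫ s in (m : ℝ)..T, deriv e s * Y s = ∫ s in (m : ℝ)..T, -(r * e s) * Y s := by
    simp_rw [fun s => (hed s).deriv]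
  rw [hd1, hd2] at hibp
  have hXi : IntervalIntegrable X volume m T := (hX.mono_left hnm').intervalIntegrable hmT
  have hbi : IntervalIntegrable b volume m T := hb.mono_set hsub
  have hIi : IntervalIntegrable I volume m T := (hIc.mono_left hnm').intervalIntegrable hmT
  have hYi : IntervalIntegrable Y volume m T :=
    (hYc.mono (Icc_subset_Icc_left hnm')).intervalIntegrable_of_Icc hmT'
  have s1 : ∫ s in (m : ℝ)..T, e s * (r * X s + b s)
      = (∫ s in (m : ℝ)..T, r * e s * X s) + ∫ s in (m : ℝ)..T, e s * b s := by
    rw [← intervalIntegral.integral_add]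
    · refine intervalIntegral.integral_congr fun s _ => ?_
      ring
    · exact hXi.continuousOn_mul (by fun_prop)
    · exact hbi.continuousOn_mul (by fun_prop)
  have s2 : ∫ s in (m : ℝ)..T, r * e s * I s
      = (∫ s in (m : ℝ)..T, r * e s * X s) - (∫ s in (m : ℝ)..T, r * e s * x)
        + ∫ s in (m : ℝ)..T, -(r * e s) * Y s := by
    rw [← intervalIntegral.integral_sub, ← intervalIntegral.integral_add]
    · refine intervalIntegral.integral_congr fun s hs => ?_
      rw [uIcc_of_le hmT'] at hs
      rw [hI s ⟨hnm'.trans hs.1, hs.2⟩]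
      ring
    · exact (hXi.continuousOn_mul (by fun_prop)).sub
        ((by fun_prop : Continuous fun s => r * e s * x).intervalIntegrable _ _)
    · exact hYi.continuousOn_mul (by fun_prop)
    · exact hXi.continuousOn_mul (by fun_prop)
    · exact (by fun_prop : Continuous fun s => r * e s * x).intervalIntegrable _ _
  have s3 : ∫ s in (m : ℝ)..T, r * e s * x = (e m - e T) * x := by
    rw [intervalIntegral.integral_mul_const]
    congr 1
    have : ∀ s ∈ uIcc (m : ℝ) T, HasDerivAt (fun s => -e s) (r * e s) s := by
      intro s _
      have h := (hed s).neg
      rw [neg_neg] at h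
      exact h
    rw [intervalIntegral.integral_eq_sub_of_hasDerivAt this
      ((by fun_prop : Continuous fun s => r * e s).intervalIntegrable _ _)]
    ring
  have heT : e T = 1 := by simp [he]
  rw [hI T ⟨hnT', le_rfl⟩, hI m ⟨hnm', hmT'⟩]
  change X T - e m * X m = (∫ s in (m : ℝ)..T, e s * b s) + (X T - (x + Y T)
    - e m * (X m - (x + Y m)) + ∫ s in (m : ℝ)..T, r * e s * I s)
  rw [s2, s3, heT]
  rw [s1, heT] at hibp
  linarith

end Paths

section Piecewise

/-! ### Functions that are continuous on each period -/

/-- The index `k` of the period `(k, k + 1]` that contains `s`, but at least `n`. -/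
noncomputable def period (n : ℕ) (s : ℝ) : ℕ := max n (⌈s⌉₊ - 1)

lemma measurable_period (n : ℕ) : Measurable (period n) :=
  (measurable_from_nat (f := fun k => max n (k - 1))).comp Nat.measurable_ceil

lemma period_eq {n : ℕ} {s : ℝ} (hs : (n : ℝ) < s) : period n s = ⌈s⌉₊ - 1 := by
  have : n < ⌈s⌉₊ := Nat.lt_ceil.2 hs
  unfold period
  omega

lemma period_le {n T : ℕ} (hn : n ≤ T) {s : ℝ} (hs : s ≤ T) : period n s ≤ T := by
  have : ⌈s⌉₊ ≤ T := Nat.ceil_le.2 hs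
  unfold period
  omega

lemma period_eventuallyEq (n : ℕ) {s : ℝ} (hs0 : 0 < s) (hs : s ∉ range ((↑) : ℕ → ℝ)) :
    ∀ᶠ t in 𝓝 s, period n t = period n s := by
  have h0 : ⌈s⌉₊ ≠ 0 := (Nat.ceil_pos.2 hs0).ne'
  have h1 : ((⌈s⌉₊ - 1 : ℕ) : ℝ) < s := ((Nat.ceil_eq_iff h0).1 rfl).1
  have h2 : s < ⌈s⌉₊ := lt_of_le_of_ne (Nat.le_ceil s) fun h => hs ⟨_, h.symm⟩
  filter_upwards [Ioo_mem_nhds h1 h2] with t ht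
  have : ⌈t⌉₊ = ⌈s⌉₊ := (Nat.ceil_eq_iff h0).2 ⟨ht.1, ht.2.le⟩
  simp only [period, this]

variable {g : ℕ → ℝ → ℝ} {n m T : ℕ}

lemma exists_bound_period (hg : ∀ k, ContinuousOn (g k) (Icc 0 (T : ℝ))) (hn : n ≤ T) :
    ∃ C, ∀ s ∈ Icc (0 : ℝ) T, |g (period n s) s| ≤ C := by
  have h : ∀ k, ∃ C, ∀ s ∈ Icc (0 : ℝ) T, ‖g k s‖ ≤ C := fun k =>
    isCompact_Icc.exists_bound_of_continuousOn (hg k)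
  choose C hC using h
  refine ⟨∑ k ∈ Finset.range (T + 1), |C k|, fun s hs => ?_⟩
  calc |g (period n s) s| ≤ |C (period n s)| := (hC _ s hs).trans (le_abs_self _)
    _ ≤ _ := Finset.single_le_sum (f := fun k => |C k|) (fun k _ => abs_nonneg _)
        (Finset.mem_range.2 (Nat.lt_succ_of_le (period_le hn hs.2)))

lemma aestronglyMeasurable_period (hg : ∀ k, ContinuousOn (g k) (Icc 0 (T : ℝ))) (n : ℕ) :
    AEStronglyMeasurable (fun s => g (period n s) s) (volume.restrict (Icc (0 : ℝ) T)) := by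
  have hT : (0 : ℝ) ≤ T := T.cast_nonneg
  have hc : ∀ k, Continuous (IccExtend hT ((Icc (0 : ℝ) T).domRestrict (g k))) := fun k =>
    (hg k).domRestrict.Icc_extend'
  have hm : Measurable (fun p : ℕ × ℝ => IccExtend hT ((Icc (0 : ℝ) T).domRestrict (g p.1)) p.2) :=
    measurable_from_prod_countable_right fun k => (hc k).measurable
  refine (hm.comp ((measurable_period n).prodMk measurable_id)).aestronglyMeasurable.congr ?_
  filter_upwards [ae_restrict_mem measurableSet_Icc] with s hs
  simp [IccExtend_of_mem hT _ hs, Set.domRestrict]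

lemma intervalIntegrable_period (hg : ∀ k, ContinuousOn (g k) (Icc 0 (T : ℝ))) (hn : n ≤ T)
    (hm : m ≤ T) : IntervalIntegrable (fun s => g (period n s) s) volume m T := by
  have hm' : (m : ℝ) ≤ T := by exact_mod_cast hm
  obtain ⟨C, hC⟩ := exists_bound_period hg hn
  rw [intervalIntegrable_iff_integrableOn_Ioc_of_le hm']
  have hsub : Ioc (m : ℝ) T ⊆ Icc 0 T := fun s hs => ⟨m.cast_nonneg.trans hs.1.le, hs.2⟩
  refine Integrable.of_bound ((aestronglyMeasurable_period hg n).mono_measure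
    (Measure.restrict_mono hsub le_rfl)) C ?_
  filter_upwards [ae_restrict_mem measurableSet_Ioc] with s hs
  exact hC s (hsub hs)

lemma ae_continuousWithinAt_period (hg : ∀ k, ContinuousOn (g k) (Icc 0 (T : ℝ))) (n m : ℕ) :
    ∀ᵐ s, s ∈ Ioc (m : ℝ) T →
      ContinuousWithinAt (fun s => g (period n s) s) (Icc m s) s := by
  filter_upwards [(countable_range ((↑) : ℕ → ℝ)).ae_notMem volume] with s hs hs'
  have hm0 : (0 : ℝ) ≤ m := m.cast_nonneg
  have h1 : ContinuousWithinAt (g (period n s)) (Icc m s) s :=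
    (hg _ s ⟨hm0.trans hs'.1.le, hs'.2⟩).mono (Icc_subset_Icc hm0 hs'.2)
  refine h1.congr_of_eventuallyEq ?_ rfl
  filter_upwards [mem_nhdsWithin_of_mem_nhds
    (period_eventuallyEq n (hm0.trans_lt hs'.1) hs)] with t ht
  rw [ht]

/-- Riemann sums over the grid `m + j / N` of a function which is continuous on each period. -/
lemma tendsto_riemann_period (hg : ∀ k, ContinuousOn (g k) (Icc 0 (T : ℝ))) (hn : n ≤ T)
    (hm : m ≤ T) :
    Tendsto (fun N : ℕ => ∑ j ∈ Finset.range ((T - m) * N),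
        1 / (N : ℝ) * g (period n (m + j / N)) (m + j / N)) atTop
      (𝓝 (∫ s in (m : ℝ)..T, g (period n s) s)) := by
  obtain ⟨C, hC⟩ := exists_bound_period hg hn
  have hm0 : (0 : ℝ) ≤ m := m.cast_nonneg
  refine (tendsto_integral_gridDn (q := fun s => g (period n s) s) hm
    (fun s hs => hC s ⟨hm0.trans hs.1, hs.2⟩) (ae_continuousWithinAt_period hg n m)).congr' ?_
  filter_upwards [eventually_gt_atTop 0] with N hN
  have hN' : (0 : ℝ) < N := by exact_mod_cast hN
  have hend : (m : ℝ) + (((T - m) * N : ℕ) : ℝ) / N = T := by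
    push_cast [Nat.cast_sub hm]; field_simp; ring
  have h1 := sum_integral_grid (m := (m : ℝ)) hN ((T - m) * N) (k := fun _ => 1)
    continuous_const (fun j => g (period n (m + j / N)) (m + j / N))
  rw [hend] at h1
  simp only [one_mul] at h1
  change ∫ s in (m : ℝ)..T, g (period n (gridDn m N s)) (gridDn m N s) = _
  simp only [gridDn]
  rw [← h1]
  refine Finset.sum_congr rfl fun j _ => ?_
  rw [intervalIntegral.integral_const, smul_eq_mul, mul_one]
  congr 1
  field_simp
  ring

end Piecewise

section StochasticIntegral

/-! ### Discretized stochastic integrals -/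

variable {d : ℕ} {Ω : Type*}

/-- At a grid point `n + k / N` the discretized integral is the sum of the first `k` terms. -/
lemma riemannSum_grid {L : ℝ≥0 → Ω → Vec d} {H : ℝ → Ω → Vec d} {n T N : ℕ} (hnT : n < T)
    (hN : 0 < N) {k : ℕ} (hk : k ≤ (T - n) * N) (ω : Ω) :
    riemannSum L H n T ((T - n) * N) (n + k / N) ω = ∑ i ∈ Finset.range k,
      ⟪H (n + i / N) ω, L (n + (i + 1) / N : ℝ).toNNReal ω - L (n + i / N : ℝ).toNNReal ω⟫ := by
  have hN' : (0 : ℝ) < N := by exact_mod_cast hN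
  have hnT' : (n : ℝ) < T := by exact_mod_cast hnT
  have hst : ((T : ℝ) - n) / (((T - n) * N : ℕ) : ℝ) = 1 / N := by
    have : (T : ℝ) - n ≠ 0 := by linarith
    push_cast [Nat.cast_sub hnT.le]
    field_simp
  unfold riemannSum
  rw [hst]
  symm
  refine Finset.sum_subset_zero_on_sdiff (Finset.range_subset_range.2 hk) ?_ ?_
  · intro i hi
    simp only [Finset.mem_sdiff, Finset.mem_range, not_lt] at hi
    have h1 : (k : ℝ) / N ≤ i * (1 / N) := by
      rw [mul_one_div]; gcongr; exact_mod_cast hi.2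
    have h2 : (k : ℝ) / N ≤ (i + 1) * (1 / N) := h1.trans (by gcongr; linarith)
    rw [min_eq_right (by linarith), min_eq_right (by linarith), sub_self, inner_zero_right]
  · intro i hi
    have hi' : i + 1 ≤ k := Finset.mem_range.1 hi
    have h2 : ((i : ℝ) + 1) * (1 / N) ≤ k / N := by
      rw [mul_one_div]; gcongr; exact_mod_cast hi'
    have h1 : (i : ℝ) * (1 / N) ≤ k / N := le_trans (by gcongr; linarith) h2
    rw [min_eq_left (by linarith), min_eq_left (by linarith), mul_one_div, mul_one_div]

/-- `[n, T]` is divided into `(T - n) * N` intervals, so that the grid contains the integer `m` and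
the increments of the discretized integral over the grid of `[m, T]` are single terms. -/
lemma gridSum_riemannSum {L : ℝ≥0 → Ω → Vec d} {H : ℝ → Ω → Vec d} {n m T N : ℕ} (hnT : n < T)
    (hnm : n ≤ m) (hmT : m ≤ T) (hN : 0 < N) (r : ℝ) (ω : Ω) :
    gridSum r m T N (fun t => riemannSum L H n T ((T - n) * N) t ω)
      = ∑ j ∈ Finset.range ((T - m) * N), ⟪Real.exp (r * (T - (m + j / N))) • H (m + j / N) ω,
          L (m + (j + 1) / N : ℝ).toNNReal ω - L (m + j / N : ℝ).toNNReal ω⟫ := by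
  have hN' : (0 : ℝ) < N := by exact_mod_cast hN
  refine Finset.sum_congr rfl fun j hj => ?_
  have hj' : j + 1 ≤ (T - m) * N := Finset.mem_range.1 hj
  have hc : (T - n) * N = (m - n) * N + (T - m) * N := by
    rw [← add_mul]; congr 1; omega
  have hs : ∀ i : ℕ, (m : ℝ) + i / N = n + (((m - n) * N + i : ℕ) : ℝ) / N := by
    intro i
    push_cast [Nat.cast_sub hnm]
    field_simp
    ring
  have hs1 : (m : ℝ) + ((j : ℝ) + 1) / N = n + (((m - n) * N + j + 1 : ℕ) : ℝ) / N := by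
    have := hs (j + 1)
    push_cast at this ⊢
    rw [this]; ring
  rw [real_inner_smul_left]
  congr 1
  have e1 := riemannSum_grid (L := L) (H := H) (k := (m - n) * N + j + 1) hnT hN (by omega) ω
  have e2 := riemannSum_grid (L := L) (H := H) (k := (m - n) * N + j) hnT hN (by omega) ω
  rw [hs1, hs j]
  simp only [e1, e2, Finset.sum_range_succ, add_sub_cancel_left]
  push_cast
  rfl

lemma gridSum_sub (r : ℝ) (m T N : ℕ) (f g : ℝ → ℝ) :
    gridSum r m T N f - gridSum r m T N g = gridSum r m T N (fun t => f t - g t) := by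
  simp only [gridSum, ← Finset.sum_sub_distrib]
  exact Finset.sum_congr rfl fun j _ => by ring

variable [MeasurableSpace Ω]

/-- The stochastic integral vanishes at the left end point. -/
lemma IsStochIntegral.ae_eq_zero_left {P : Measure Ω} {L : ℝ≥0 → Ω → Vec d}
    {H : ℝ → Ω → Vec d} {a b : ℝ} (hab : a ≤ b) {I : ℝ → Ω → ℝ}
    (hI : IsStochIntegral P L H a b I) : ∀ᵐ ω ∂P, I a ω = 0 := by
  have hz : ∀ K ω, riemannSum L H a b K a ω = 0 := by
    intro K ω
    refine Finset.sum_eq_zero fun k _ => ?_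
    have h0 : 0 ≤ (b - a) / K := div_nonneg (by linarith) K.cast_nonneg
    rw [min_eq_right (le_add_of_nonneg_right (by positivity)),
      min_eq_right (le_add_of_nonneg_right (by positivity)), sub_self, inner_zero_right]
  have key : ∀ i : ℕ, P {ω | 1 / ((i : ℝ) + 1) ≤ |I a ω|} = 0 := by
    intro i
    refine le_antisymm (ge_of_tendsto' (hI (1 / ((i : ℝ) + 1)) (by positivity)) fun K => ?_)
      zero_le
    refine measure_mono fun ω hω => ⟨a, ⟨le_rfl, hab⟩, ?_⟩
    rw [hz, zero_sub, abs_neg]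
    exact hω
  have := ae_all_iff.2 fun i => measure_eq_zero_iff_ae_notMem.1 (key i)
  filter_upwards [this] with ω hω
  by_contra h
  obtain ⟨i, hi⟩ := exists_nat_one_div_lt (abs_pos.2 h)
  exact hω i hi.le

/-- Convergence in probability of the discounted sums of the discretized stochastic integral. -/
lemma IsStochIntegral.tendstoInMeasure_gridSum {P : Measure Ω} {L : ℝ≥0 → Ω → Vec d}
    {H : ℝ → Ω → Vec d} {n m T : ℕ} (hnT : n < T) (hnm : n ≤ m) (hmT : m ≤ T)
    {I : ℝ → Ω → ℝ} (hI : IsStochIntegral P L H n T I) (r : ℝ) :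
    TendstoInMeasure P (fun N ω => gridSum r m T N
      (fun t => riemannSum L H n T ((T - n) * N) t ω) - gridSum r m T N (fun t => I t ω))
      atTop (fun _ => 0) := by
  rw [tendstoInMeasure_iff_norm]
  intro ε hε
  obtain ⟨C, hC, hbound⟩ := exists_gridSum_bound hmT r
  have hδ : 0 < ε / (2 * C) := by positivity
  have hsub : Tendsto (fun N => (T - n) * N) atTop atTop :=
    tendsto_id.const_mul_atTop' (by omega)
  refine tendsto_of_tendsto_of_tendsto_of_le_of_le' tendsto_const_nhds ((hI _ hδ).comp hsub)
    (Eventually.of_forall fun _ => zero_le) ?_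
  filter_upwards [eventually_gt_atTop 0] with N hN
  refine measure_mono fun ω hω => ?_
  by_contra hcon
  simp only [mem_ofPred_eq, not_exists, not_and, not_le] at hcon
  have hnm' : (n : ℝ) ≤ m := by exact_mod_cast hnm
  have h1 := hbound N hN (fun t => riemannSum L H n T ((T - n) * N) t ω - I t ω) (ε / (2 * C))
    fun t ht => (hcon t ⟨hnm'.trans ht.1, ht.2⟩).le
  have h2 : C * (ε / (2 * C)) = ε / 2 := by field_simp
  simp only [mem_ofPred_eq, sub_zero, gridSum_sub, Real.norm_eq_abs] at hω
  linarith

/-- The characteristic function of a weighted sum of increments of a Lévy process. -/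
lemma IsStableLevy.charFun_sum {P : Measure Ω} {α c : ℝ} {spec : Measure (USphere d)}
    {R : Matrix (Fin d) (Fin d) ℝ} {L : ℝ≥0 → Ω → Vec d} (hL : IsStableLevy P α c spec R L)
    {m : ℝ} (hm : 0 ≤ m) (N M : ℕ) (v : ℕ → Vec d) (ξ : ℝ) :
    charFun (P.map (fun ω => ∑ j ∈ Finset.range M,
      ⟪v j, L (m + (j + 1) / N : ℝ).toNNReal ω - L (m + j / N : ℝ).toNNReal ω⟫)) ξ
      = ∏ j ∈ Finset.range M,
        Complex.exp (((1 / N : ℝ) : ℂ) * stableExponent α c spec R (ξ • v j)) := by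
  set t : ℕ → ℝ≥0 := fun j => (m + j / N : ℝ).toNNReal with ht
  have htm : Monotone t := fun i j hij => Real.toNNReal_mono (by gcongr)
  have hts : ∀ j, t (j + 1) = t j + (1 / N : ℝ).toNNReal := by
    intro j
    rw [ht]
    simp only
    rw [← Real.toNNReal_add (by positivity) (by positivity)]
    congr 1
    push_cast
    ring
  have hind := (hL.indep.nat htm).comp (fun j x => ⟪v j, x⟫) fun j => by fun_prop
  have hmeas : ∀ j, Measurable fun ω => ⟪v j, L (t (j + 1)) ω - L (t j) ω⟫ := fun j =>
    Measurable.inner measurable_const ((hL.measurable _).sub (hL.measurable _))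
  have h1 := iIndepFun.charFun_map_fun_finsetSum_eq_prod (s := Finset.range M)
    (X := fun j ω => ⟪v j, L (t (j + 1)) ω - L (t j) ω⟫)
    (fun j _ => (hmeas j).aemeasurable) (hind.restrict _)
  have h2 := congrFun h1 ξ
  simp only [ht, Nat.cast_add, Nat.cast_one] at h2
  rw [h2, Finset.prod_apply]
  refine Finset.prod_congr rfl fun j _ => ?_
  have h3 : charFun (P.map fun ω => ⟪v j, L (t (j + 1)) ω - L (t j) ω⟫) ξ
      = charFun (P.map fun ω => L (t (j + 1)) ω - L (t j) ω) (ξ • v j) := by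
    rw [charFun_apply, charFun_apply,
      integral_map (hmeas j).aemeasurable (by fun_prop),
      integral_map (φ := fun ω => L (t (j + 1)) ω - L (t j) ω)
        ((hL.measurable _).sub (hL.measurable _)).aemeasurable (by fun_prop)]
    refine integral_congr_ae (Eventually.of_forall fun ω => ?_)
    simp only [inner_smul_right, real_inner_comm (v j)]
    simp
  have h4 := (hL.stationary (t j) (1 / N : ℝ).toNNReal).map_eq
  rw [← hts j] at h4
  rw [h4, hL.charFun_eq, Real.coe_toNNReal _ (by positivity)] at h3
  simp only [ht, Nat.cast_add, Nat.cast_one] at h3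
  exact h3

end StochasticIntegral

section Wealth

/-! ### The characteristic function of the discounted gain -/

variable {d : ℕ} (K : Market d) {Ω : Type*} [MeasurableSpace Ω]

lemma continuousOn_excess (u : Vec d) : ContinuousOn (K.excess u) (Icc 0 (K.T : ℝ)) := by
  unfold Market.excess
  refine continuousOn_finsetSum _ fun i _ => continuousOn_const.mul ?_
  refine ContinuousOn.sub ?_ continuousOn_const
  exact (by fun_prop : Continuous fun x : Vec d => x i).comp_continuousOn K.μ_cont

lemma continuousOn_exposure (u : Vec d) : ContinuousOn (K.exposure u) (Icc 0 (K.T : ℝ)) := by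
  unfold Market.exposure
  have : Continuous fun A : Matrix (Fin d) (Fin d) ℝ => WithLp.toLp 2 (Matrix.vecMul u.ofLp A) := by
    fun_prop
  exact this.comp_continuousOn K.σ_cont

/-- The discounted exposure `e^{r (T - s)} uᵀ σ_s`. -/
noncomputable def discountedExposure (u : Vec d) (s : ℝ) : Vec d :=
  Real.exp (K.r * (K.T - s)) • K.exposure u s

lemma continuousOn_discountedExposure (u : Vec d) :
    ContinuousOn (discountedExposure K u) (Icc 0 (K.T : ℝ)) := by
  unfold discountedExposure
  have : Continuous fun s : ℝ => Real.exp (K.r * (K.T - s)) := by fun_prop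
  exact this.continuousOn.smul (continuousOn_exposure K u)

variable {K} {P : Measure Ω} {L : ℝ≥0 → Ω → Vec d}

/-- The initial condition holds almost surely, because the stochastic integral starts at `0`. -/
lemma Market.IsWealth.ae_initial {n : ℕ} (hn : n ≤ K.T) {x : ℝ} {u : ControlLaw d} {X : ℝ → Ω → ℝ}
    (hX : K.IsWealth P L n x u X) : ∀ᵐ ω ∂P, X n ω = x := by
  obtain ⟨I, hI, hsde⟩ := hX.sde
  have hn' : (n : ℝ) ≤ K.T := by exact_mod_cast hn
  filter_upwards [hsde, hI.ae_eq_zero_left hn'] with ω h1 h2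
  have := h1 n ⟨le_rfl, hn'⟩
  simpa [h2] using this

/-- The characteristic function of the discounted gain over `[m, T]` of the wealth under a
deterministic control, provided that the characteristic exponent of the driving process factorizes
along the exposures of the control. -/
lemma Market.IsWealth.charFun_gain [IsProbabilityMeasure P]
    (hL : IsStableLevy P K.α K.c K.spec K.R L) {n m : ℕ} (hnT : n < K.T) (hnm : n ≤ m)
    (hmT : m ≤ K.T) {x : ℝ} {v : ℕ → Vec d} {X : ℝ → Ω → ℝ}
    (hX : K.IsWealth P L n x (det v) X) {Q : Vec d → ℝ} (hQ : Continuous Q) {ξ : ℝ} {κ : ℂ}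
    (hψ : ∀ s ∈ Icc (0 : ℝ) K.T, ∀ k,
      stableExponent K.α K.c K.spec K.R (ξ • discountedExposure K (v k) s)
        = Q (discountedExposure K (v k) s) * κ) :
    charFun (P.map fun ω => X K.T ω - Real.exp (K.r * (K.T - m)) * X m ω) ξ
      = Complex.exp (((ξ * ∫ s in (m : ℝ)..K.T,
          Real.exp (K.r * (K.T - s)) * K.excess (step v s) s : ℝ) : ℂ) * Complex.I)
        * Complex.exp (((∫ s in (m : ℝ)..K.T, Q (discountedExposure K (step v s) s) : ℝ) : ℂ)
          * κ) := by
  have hnm' : (n : ℝ) ≤ m := by exact_mod_cast hnm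
  have hmT' : (m : ℝ) ≤ K.T := by exact_mod_cast hmT
  have hm0 : (0 : ℝ) ≤ m := m.cast_nonneg
  obtain ⟨I, hI, hsde⟩ := hX.sde
  set b : ℝ → ℝ := fun s => K.excess (v (period n s)) s with hb
  set a : ℝ := ∫ s in (m : ℝ)..K.T, Real.exp (K.r * (K.T - s)) * b s with ha
  set h : ℝ → Vec d := fun s => discountedExposure K (v (period n s)) s with hh
  have hbint : IntervalIntegrable b volume n K.T :=
    intervalIntegrable_period (g := fun k => K.excess (v k)) (fun k => continuousOn_excess K _)
      hnT.le hnT.le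
  set S : ℕ → Ω → ℝ := fun N ω => ∑ j ∈ Finset.range ((K.T - m) * N), ⟪h (m + j / N),
    L (m + (j + 1) / N : ℝ).toNNReal ω - L (m + j / N : ℝ).toNNReal ω⟫ with hS
  set Z : Ω → ℝ := fun ω => X K.T ω - Real.exp (K.r * (K.T - m)) * X m ω with hZ
  have hSmeas : ∀ N, Measurable (S N) := fun N =>
    Finset.measurable_sum _ fun j _ =>
      Measurable.inner measurable_const ((hL.measurable _).sub (hL.measurable _))
  have hZmeas : Measurable Z :=
    (hX.measurable _ ⟨hnm'.trans hmT', le_rfl⟩).sub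
      ((hX.measurable _ ⟨hnm', hmT'⟩).const_mul _)
  have hdiff := hI.tendstoInMeasure_gridSum hnT hnm hmT K.r
  obtain ⟨ns, hns, hae⟩ := hdiff.exists_seq_tendsto_ae
  have hlim : ∀ᵐ ω ∂P, Tendsto (fun k => S (ns k) ω) atTop (𝓝 (Z ω - a)) := by
    filter_upwards [hae, hX.cadlag, hsde] with ω h1 h2 h3
    obtain ⟨hIc, hsol⟩ := linear_solution (X := fun s => X s ω) (b := b)
      (I := fun s => I s ω) (x := x) (r := K.r) hnm hmT h2 hbint h3
    have h4 := ((hIc.mono_left hnm').tendsto_gridSum hmT K.r).comp hns.tendsto_atTop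
    have h5 := h1.add h4
    have h6 : Z ω - a = 0 + (I K.T ω - Real.exp (K.r * (K.T - m)) * I m ω
        + ∫ s in (m : ℝ)..K.T, K.r * Real.exp (K.r * (K.T - s)) * I s ω) := by
      simp only [hZ, ha]
      linarith
    rw [h6]
    refine h5.congr' ?_
    filter_upwards [hns.tendsto_atTop.eventually (eventually_gt_atTop 0)] with k hk
    simp only [Function.comp_apply]
    rw [sub_add_cancel, gridSum_riemannSum hnT hnm hmT hk]
    rfl
  -- the laws of the sums converge along the subsequence, and their characteristic functions are
  -- exponentials of Riemann sums
  have hcf1 : Tendsto (fun k => charFun (P.map (S (ns k))) ξ) atTop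
      (𝓝 (charFun (P.map fun ω => Z ω - a) ξ)) := by
    simp only [charFun_apply_real]
    rw [integral_map (hZmeas.sub_const a).aemeasurable (by fun_prop)]
    simp_rw [fun k => integral_map (μ := P) (hSmeas (ns k)).aemeasurable
      (f := fun y : ℝ => Complex.exp (ξ * y * Complex.I)) (by fun_prop)]
    refine tendsto_integral_of_dominated_convergence (fun _ => 1) ?_ (integrable_const _) ?_ ?_
    · intro k
      have := hSmeas (ns k)
      exact (by fun_prop : Measurable fun ω => Complex.exp (ξ * S (ns k) ω * Complex.I)).aestronglyMeasurable
    · intro k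
      refine Eventually.of_forall fun ω => ?_
      rw [← Complex.ofReal_mul, Complex.norm_exp_ofReal_mul_I]
    · filter_upwards [hlim] with ω hω
      have hc : Continuous fun y : ℝ => Complex.exp (ξ * y * Complex.I) := by fun_prop
      exact (hc.tendsto _).comp hω
  have hcf2 : Tendsto (fun N => charFun (P.map (S N)) ξ) atTop
      (𝓝 (Complex.exp (((∫ s in (m : ℝ)..K.T, Q (h s) : ℝ) : ℂ) * κ))) := by
    have hr := tendsto_riemann_period (g := fun k s => Q (discountedExposure K (v k) s))
      (fun k => hQ.comp_continuousOn (continuousOn_discountedExposure K _)) hnT.le hmT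
    have hc : Continuous fun y : ℝ => Complex.exp ((y : ℂ) * κ) := by fun_prop
    refine ((hc.tendsto _).comp hr).congr' ?_
    filter_upwards [eventually_gt_atTop 0] with N hN
    have hN' : (0 : ℝ) < N := by exact_mod_cast hN
    simp only [Function.comp_apply, hS]
    rw [hL.charFun_sum hm0, ← Complex.exp_sum, Complex.ofReal_sum, Finset.sum_mul]
    congr 1
    refine Finset.sum_congr rfl fun j hj => ?_
    have hj' : ((j : ℝ)) ≤ (K.T - m) * N := by
      have := (Finset.mem_range.1 hj).le
      rw [← Nat.cast_sub hmT]
      exact_mod_cast this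
    have hj2 : (j : ℝ) / N ≤ K.T - m := by rwa [div_le_iff₀ hN']
    rw [hh, hψ _ ⟨by positivity, by linarith⟩]
    push_cast
    ring
  have heq := tendsto_nhds_unique hcf1 (hcf2.comp hns.tendsto_atTop)
  have hshift : charFun (P.map Z) ξ
      = Complex.exp (((ξ * a : ℝ) : ℂ) * Complex.I) * charFun (P.map fun ω => Z ω - a) ξ := by
    simp only [charFun_apply_real]
    rw [integral_map (hZmeas.sub_const a).aemeasurable (by fun_prop),
      integral_map hZmeas.aemeasurable (by fun_prop), ← integral_const_mul]
    refine integral_congr_ae (Eventually.of_forall fun ω => ?_)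
    simp only
    rw [← Complex.exp_add]
    congr 1
    push_cast
    ring
  -- on `(m, T]` the lower bound `n` on the period is not active
  have hstep : ∀ s ∈ uIoc (m : ℝ) K.T, v (period n s) = step v s := by
    intro s hs
    rw [uIoc_of_le hmT'] at hs
    rw [period_eq (hnm'.trans_lt hs.1)]
    rfl
  have e1 : a = ∫ s in (m : ℝ)..K.T, Real.exp (K.r * (K.T - s)) * K.excess (step v s) s := by
    refine intervalIntegral.integral_congr_ae (Eventually.of_forall fun s hs => ?_)
    simp only [hb, hstep s hs]
  have e2 : ∫ s in (m : ℝ)..K.T, Q (h s)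
      = ∫ s in (m : ℝ)..K.T, Q (discountedExposure K (step v s) s) := by
    refine intervalIntegral.integral_congr_ae (Eventually.of_forall fun s hs => ?_)
    simp only [hh, hstep s hs]
  rw [hshift, heq, e1, e2]

end Wealth

section Exponent

/-! ### The stable characteristic exponent in polar coordinates -/

/-- The radial part `c / w ^ (α + 1) dw` of the `α`-stable Lévy measure. -/
noncomputable def radialMeasure (α c : ℝ) : Measure ℝ :=
  (volume.restrict (Ioi (0 : ℝ))).withDensity (fun w => ENNReal.ofReal (c / w ^ (α + 1)))

/-- The compensated exponential `e^{iθ} - 1 - iθ`. -/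
noncomputable def compExp (θ : ℝ) : ℂ := Complex.exp (θ * Complex.I) - 1 - θ * Complex.I

/-- The contribution `∫₀^∞ (e^{iwθ} - 1 - iwθ) c / w ^ (α + 1) dw` of a direction `v` with
`⟨v, y⟩ = θ` to the characteristic exponent at `y`. -/
noncomputable def radialExponent (α c θ : ℝ) : ℂ := ∫ w, compExp (w * θ) ∂(radialMeasure α c)

lemma continuous_compExp : Continuous compExp := by unfold compExp; fun_prop

lemma norm_compExp_le (θ : ℝ) : ‖compExp θ‖ ≤ 3 * min (θ ^ 2) |θ| := by
  have hn : ‖(θ : ℂ) * Complex.I‖ = |θ| := by simp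
  rcases le_total |θ| 1 with h | h
  · have h1 := Complex.norm_exp_sub_one_sub_id_le (x := (θ : ℂ) * Complex.I) (by rwa [hn])
    rw [hn, sq_abs] at h1
    have h2 : θ ^ 2 ≤ |θ| := by rw [← sq_abs]; nlinarith [abs_nonneg θ]
    rw [min_eq_left h2]
    unfold compExp
    nlinarith [sq_nonneg θ]
  · have h2 : |θ| ≤ θ ^ 2 := by rw [← sq_abs]; nlinarith
    rw [min_eq_right h2]
    unfold compExp
    calc _ ≤ ‖Complex.exp (θ * Complex.I)‖ + ‖(1 : ℂ)‖ + ‖(θ : ℂ) * Complex.I‖ :=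
          (norm_sub_le _ _).trans (by gcongr; exact norm_sub_le _ _)
      _ = 1 + 1 + |θ| := by rw [Complex.norm_exp_ofReal_mul_I, norm_one, hn]
      _ ≤ 3 * |θ| := by linarith

lemma measurable_radialDensity (α c : ℝ) :
    Measurable fun w : ℝ => ENNReal.ofReal (c / w ^ (α + 1)) := by fun_prop

variable {α c : ℝ}

/-- `w ^ 2` is integrable at `0` since `α < 2`, and `w` is integrable at `∞` since `1 < α`. -/
lemma integrable_min_radialMeasure (h1 : 1 < α) (h2 : α < 2) (hc : 0 < c) :
    Integrable (fun w : ℝ => min (w ^ 2) |w|) (radialMeasure α c) := by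
  unfold radialMeasure
  rw [integrable_withDensity_iff_integrable_smul' (measurable_radialDensity α c)
    (Eventually.of_forall fun _ => ENNReal.ofReal_lt_top)]
  have hU : Ioi (0 : ℝ) = Ioc 0 1 ∪ Ioi 1 := (Ioc_union_Ioi_eq_Ioi zero_le_one).symm
  change IntegrableOn _ (Ioi (0 : ℝ)) volume
  rw [hU, integrableOn_union]
  constructor
  · have hi : IntegrableOn (fun w : ℝ => c * w ^ (1 - α)) (Ioc 0 1) := by
      rw [← intervalIntegrable_iff_integrableOn_Ioc_of_le zero_le_one]
      exact (intervalIntegral.intervalIntegrable_rpow' (by linarith)).const_mul c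
    refine hi.congr_fun (fun w hw => ?_) measurableSet_Ioc
    have hw0 : 0 < w := hw.1
    have hle : w ^ 2 ≤ |w| := by rw [abs_of_pos hw0]; nlinarith [hw.2]
    have hp : 0 < w ^ (α + 1) := Real.rpow_pos_of_pos hw0 _
    simp only [min_eq_left hle, smul_eq_mul]
    rw [ENNReal.toReal_ofReal (by positivity), div_mul_eq_mul_div, mul_div_assoc]
    congr 1
    rw [← Real.rpow_natCast w 2, ← Real.rpow_sub hw0]
    congr 1
    push_cast
    ring
  · have hi : IntegrableOn (fun w : ℝ => c * w ^ (-α)) (Ioi 1) :=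
      (integrableOn_Ioi_rpow_of_lt (by linarith) zero_lt_one).const_mul c
    refine hi.congr_fun (fun w hw => ?_) measurableSet_Ioi
    have hw1 : (1 : ℝ) < w := hw
    have hw0 : 0 < w := by linarith
    have hle : |w| ≤ w ^ 2 := by rw [abs_of_pos hw0]; nlinarith
    have hp : 0 < w ^ (α + 1) := Real.rpow_pos_of_pos hw0 _
    simp only [min_eq_right hle, smul_eq_mul]
    rw [ENNReal.toReal_ofReal (by positivity), abs_of_pos hw0, div_mul_eq_mul_div, mul_div_assoc]
    congr 1
    nth_rewrite 2 [← Real.rpow_one w]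
    rw [← Real.rpow_sub hw0]
    congr 1
    ring

lemma radialExponent_eq (hc : 0 < c) (θ : ℝ) :
    radialExponent α c θ = ∫ w in Ioi (0 : ℝ), (c / w ^ (α + 1)) • compExp (w * θ) := by
  unfold radialExponent radialMeasure
  rw [integral_withDensity_eq_integral_toReal_smul (measurable_radialDensity α c)
    (Eventually.of_forall fun _ => ENNReal.ofReal_lt_top)]
  refine setIntegral_congr_fun measurableSet_Ioi fun w hw => ?_
  have hp : 0 < w ^ (α + 1) := Real.rpow_pos_of_pos hw _
  rw [ENNReal.toReal_ofReal (by positivity)]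

lemma radialExponent_mul (h1 : 1 < α) (hc : 0 < c) {l : ℝ} (hl : 0 ≤ l) (θ : ℝ) :
    radialExponent α c (l * θ) = ((l ^ α : ℝ) : ℂ) * radialExponent α c θ := by
  rcases hl.eq_or_lt with rfl | hl
  · rw [Real.zero_rpow (by linarith)]
    simp [radialExponent, compExp]
  · rw [radialExponent_eq hc, radialExponent_eq hc]
    have h := integral_comp_mul_left_Ioi
      (fun w : ℝ => (c / w ^ (α + 1)) • compExp (w * θ)) 0 hl
    rw [mul_zero] at h
    have h' : ∫ w in Ioi (0 : ℝ), (c / w ^ (α + 1)) • compExp (w * (l * θ))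
        = (l ^ (α + 1)) • ∫ w in Ioi (0 : ℝ), (c / (l * w) ^ (α + 1)) • compExp (l * w * θ) := by
      rw [← integral_smul]
      refine setIntegral_congr_fun measurableSet_Ioi fun w hw => ?_
      have hw0 : 0 < w := hw
      have hp : 0 < w ^ (α + 1) := Real.rpow_pos_of_pos hw0 _
      have hp' : 0 < l ^ (α + 1) := Real.rpow_pos_of_pos hl _
      rw [smul_smul, Real.mul_rpow hl.le hw0.le, show w * (l * θ) = l * w * θ by ring]
      congr 1
      field_simp
    rw [h', h, smul_smul, Complex.real_smul]
    congr 2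
    rw [Real.rpow_add_one hl.ne']
    field_simp

lemma radialExponent_neg (θ : ℝ) :
    radialExponent α c (-θ) = (starRingEnd ℂ) (radialExponent α c θ) := by
  unfold radialExponent
  rw [← integral_conj]
  refine integral_congr_ae (Eventually.of_forall fun w => ?_)
  simp [compExp, ← Complex.exp_conj]

lemma radialExponent_re (h1 : 1 < α) (hc : 0 < c) (θ : ℝ) :
    (radialExponent α c θ).re = |θ| ^ α * (radialExponent α c 1).re := by
  rcases le_total 0 θ with h | h
  · have := radialExponent_mul (c := c) h1 hc h 1
    rw [mul_one] at this
    rw [this, Complex.re_ofReal_mul, abs_of_nonneg h]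
  · have := radialExponent_mul (c := c) h1 hc (neg_nonneg.2 h) 1
    rw [mul_one, radialExponent_neg] at this
    have h2 := congrArg Complex.re this
    rw [Complex.conj_re, Complex.re_ofReal_mul] at h2
    rw [h2, abs_of_nonpos h]

variable {d : ℕ} {spec : Measure (USphere d)} {R : Matrix (Fin d) (Fin d) ℝ}

/-- Integrability in polar coordinates, without which the Lévy-Khintchine integral would take the
value `0` by convention. -/
lemma integrable_compExp [IsProbabilityMeasure spec] (h1 : 1 < α) (h2 : α < 2) (hc : 0 < c)
    (y : Vec d) : Integrable (fun p : USphere d × ℝ => compExp (p.2 * ⟪(p.1 : Vec d), y⟫))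
      (spec.prod (radialMeasure α c)) := by
  have : SFinite (radialMeasure α c) := by unfold radialMeasure; infer_instance
  have hb : Integrable (fun p : USphere d × ℝ => 3 * ((‖y‖ ^ 2 + ‖y‖) * min (p.2 ^ 2) |p.2|))
      (spec.prod (radialMeasure α c)) :=
    (((integrable_min_radialMeasure h1 h2 hc).comp_snd spec).const_mul _).const_mul _
  refine hb.mono' ?_ (Eventually.of_forall fun p => ?_)
  · have : Continuous fun p : USphere d × ℝ => compExp (p.2 * ⟪(p.1 : Vec d), y⟫) :=
      continuous_compExp.comp (by fun_prop)
    exact this.aestronglyMeasurable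
  · refine (norm_compExp_le _).trans ?_
    have hin : |⟪(p.1 : Vec d), y⟫| ≤ ‖y‖ := by
      have := abs_real_inner_le_norm (p.1 : Vec d) y
      rwa [show ‖(p.1 : Vec d)‖ = 1 by simp, one_mul] at this
    have hy := norm_nonneg y
    gcongr
    rcases le_total (p.2 ^ 2) |p.2| with h | h
    · rw [min_eq_left h]
      refine (min_le_left _ _).trans ?_
      have h3 : ⟪(p.1 : Vec d), y⟫ ^ 2 ≤ ‖y‖ ^ 2 := by
        rw [← sq_abs]; gcongr
      rw [mul_pow]
      nlinarith [sq_nonneg p.2]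
    · rw [min_eq_right h]
      refine (min_le_right _ _).trans ?_
      rw [abs_mul]
      have := abs_nonneg p.2
      nlinarith [sq_nonneg ‖y‖, mul_nonneg this (sq_nonneg ‖y‖)]

/-- The characteristic exponent in polar coordinates. -/
lemma stableExponent_polar [IsProbabilityMeasure spec] (h1 : 1 < α) (h2 : α < 2) (hc : 0 < c)
    (y : Vec d) : Integrable (fun v : USphere d => radialExponent α c ⟪(v : Vec d), y⟫) spec ∧
      stableExponent α c spec R y
        = ∫ v : USphere d, radialExponent α c ⟪(v : Vec d), y⟫ ∂spec := by
  have : SFinite (radialMeasure α c) := by unfold radialMeasure; infer_instance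
  have hi := integrable_compExp (spec := spec) h1 h2 hc y
  refine ⟨hi.integral_prod_left, ?_⟩
  rw [stableExponent, if_pos h2]
  change ∫ x, compExp ⟪x, y⟫
    ∂((spec.prod (radialMeasure α c)).map (fun p => p.2 • (p.1 : Vec d))) = _
  rw [integral_map (by fun_prop)
    (f := fun x : Vec d => compExp ⟪x, y⟫)
    (continuous_compExp.comp (by fun_prop : Continuous fun x : Vec d => ⟪x, y⟫)).aestronglyMeasurable]
  simp only [real_inner_smul_left]
  exact integral_prod _ hi

lemma stableExponent_smul [IsProbabilityMeasure spec] (h1 : 1 < α) (h2 : α < 2) (hc : 0 < c)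
    {l : ℝ} (hl : 0 ≤ l) (y : Vec d) :
    stableExponent α c spec R (l • y) = ((l ^ α : ℝ) : ℂ) * stableExponent α c spec R y := by
  rw [(stableExponent_polar h1 h2 hc _).2, (stableExponent_polar h1 h2 hc _).2,
    ← integral_const_mul]
  simp only [real_inner_smul_right, radialExponent_mul h1 hc hl]

/-- The spherical moment `∫ |⟨v, y⟩|^α σ̃(dv)`. -/
noncomputable def sphereMoment (α : ℝ) (spec : Measure (USphere d)) (y : Vec d) : ℝ :=
  ∫ v : USphere d, |⟪(v : Vec d), y⟫| ^ α ∂spec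

/-- By scaling, the real part of the radial integral in direction `θ` is `|θ| ^ α` times its value
at `θ = 1`; the imaginary part depends on the sign of `θ`. -/
lemma stableExponent_re [IsProbabilityMeasure spec] (h1 : 1 < α) (h2 : α < 2) (hc : 0 < c)
    (y : Vec d) : (stableExponent α c spec R y).re
      = sphereMoment α spec y * (radialExponent α c 1).re := by
  obtain ⟨hi, he⟩ := stableExponent_polar (R := R) (spec := spec) h1 h2 hc y
  rw [he, sphereMoment, ← integral_mul_const]
  have := integral_re hi
  simp only [RCLike.re_to_complex] at this
  rw [← this]
  exact integral_congr_ae (Eventually.of_forall fun v => radialExponent_re h1 hc _)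

variable {Ω : Type*} [MeasurableSpace Ω] {P : Measure Ω} {L : ℝ≥0 → Ω → Vec d}

/-- The characteristic exponent of a symmetric process is real. -/
lemma IsStableLevy.exponent_im (hL : IsStableLevy P α c spec R L) (hs : IsSymmetric P L)
    (y : Vec d) : (stableExponent α c spec R y).im = 0 := by
  have hzero : ∀ t : ℝ≥0, Real.sin (t * (stableExponent α c spec R y).im) = 0 := by
    intro t
    have h1 := hL.charFun_eq t y
    have h2 : charFun (P.map (L t)) y = (starRingEnd ℂ) (charFun (P.map (L t)) y) := by
      rw [← charFun_neg, charFun_apply, charFun_apply]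
      nth_rewrite 1 [(hs t).map_eq]
      rw [integral_map (φ := fun ω => -L t ω) (hL.measurable t).neg.aemeasurable (by fun_prop),
        integral_map (hL.measurable t).aemeasurable (by fun_prop)]
      simp only [inner_neg_left, inner_neg_right]
    have h3 := Complex.conj_eq_iff_im.1 h2.symm
    rw [h1, Complex.exp_im] at h3
    have h4 := (mul_eq_zero.1 h3).resolve_left (Real.exp_pos _).ne'
    simpa using h4
  -- at `t = π / (2 |β|)` the sine is `± 1`
  by_contra h
  set β := (stableExponent α c spec R y).im
  have h5 := hzero ⟨Real.pi / (2 * |β|), by positivity⟩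
  change Real.sin (Real.pi / (2 * |β|) * β) = 0 at h5
  have hb : 0 < |β| := abs_pos.2 h
  rcases le_total 0 β with hp | hp
  · rw [abs_of_nonneg hp] at h5 hb
    rw [show Real.pi / (2 * β) * β = Real.pi / 2 by field_simp, Real.sin_pi_div_two] at h5
    exact one_ne_zero h5
  · rw [abs_of_nonpos hp] at h5 hb
    rw [show Real.pi / (2 * -β) * β = -(Real.pi / 2) by field_simp, Real.sin_neg,
      Real.sin_pi_div_two] at h5
    norm_num at h5

lemma IsStableLevy.exponent_symmetric [IsProbabilityMeasure spec] (h1 : 1 < α) (h2 : α < 2)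
    (hc : 0 < c) (hL : IsStableLevy P α c spec R L) (hs : IsSymmetric P L) (y : Vec d) :
    stableExponent α c spec R y
      = (sphereMoment α spec y : ℂ) * ((radialExponent α c 1).re : ℂ) := by
  rw [← Complex.ofReal_mul, ← stableExponent_re (R := R) h1 h2 hc]
  refine Complex.ext (by simp) ?_
  rw [hL.exponent_im hs, Complex.ofReal_im]

lemma IsStableLevy.charFun_inner (hL : IsStableLevy P α c spec R L) (t : ℝ≥0) (b : Vec d) (ξ : ℝ) :
    charFun (P.map fun ω => ⟪b, L t ω⟫) ξ
      = Complex.exp (((t : ℝ) : ℂ) * stableExponent α c spec R (ξ • b)) := by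
  rw [← hL.charFun_eq, charFun_apply, charFun_apply,
    integral_map (Measurable.inner measurable_const (hL.measurable t)).aemeasurable (by fun_prop),
    integral_map (hL.measurable t).aemeasurable (by fun_prop)]
  refine integral_congr_ae (Eventually.of_forall fun ω => ?_)
  simp only [inner_smul_right, real_inner_comm b]
  simp

lemma continuous_sphereMoment [IsFiniteMeasure spec] (h0 : 0 < α) :
    Continuous (sphereMoment α spec) := by
  have h := continuous_parametric_integral_of_continuous (μ := spec)
    (f := fun (y : Vec d) (v : USphere d) => |⟪(v : Vec d), y⟫| ^ α)
    (by
      have : Continuous fun p : Vec d × USphere d => |⟪(p.2 : Vec d), p.1⟫| := by fun_prop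
      exact this.rpow_const fun _ => Or.inr h0.le) isCompact_univ
  simpa [sphereMoment] using! h

lemma sphereMoment_nonneg (y : Vec d) : 0 ≤ sphereMoment α spec y :=
  integral_nonneg fun _ => by positivity

lemma sphereMoment_smul (l : ℝ) (y : Vec d) :
    sphereMoment α spec (l • y) = |l| ^ α * sphereMoment α spec y := by
  unfold sphereMoment
  rw [← integral_const_mul]
  refine integral_congr_ae (Eventually.of_forall fun v => ?_)
  simp only [real_inner_smul_right]
  rw [abs_mul, Real.mul_rpow (abs_nonneg _) (abs_nonneg _)]

/-- Some coordinate has a positive spherical moment, since the sphere avoids the origin. -/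
lemma exists_sphereMoment_pos [IsProbabilityMeasure spec] (h0 : 0 < α) :
    ∃ y, 0 < sphereMoment α spec y := by
  by_contra! hcon
  have hae : ∀ i : Fin d, ∀ᵐ v : USphere d ∂spec, (v : Vec d) i = 0 := by
    intro i
    have hz : sphereMoment α spec (EuclideanSpace.single i 1) = 0 :=
      le_antisymm (hcon _) (sphereMoment_nonneg _)
    have hcont : Continuous fun v : USphere d =>
        |⟪(v : Vec d), (EuclideanSpace.single i 1 : Vec d)⟫| ^ α := by
      have : Continuous fun v : USphere d =>
        |⟪(v : Vec d), (EuclideanSpace.single i 1 : Vec d)⟫| := by fun_prop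
      exact this.rpow_const fun _ => Or.inr h0.le
    have hint : Integrable (fun v : USphere d =>
        |⟪(v : Vec d), (EuclideanSpace.single i 1 : Vec d)⟫| ^ α) spec :=
      integrableOn_univ.1 (hcont.continuousOn.integrableOn_compact isCompact_univ)
    have := (integral_eq_zero_iff_of_nonneg (fun _ => by positivity) hint).1 hz
    filter_upwards [this] with v hv
    have h2 : |⟪(v : Vec d), (EuclideanSpace.single i 1 : Vec d)⟫| ^ α = 0 := hv
    rw [Real.rpow_eq_zero (abs_nonneg _) h0.ne', abs_eq_zero] at h2
    simpa [EuclideanSpace.inner_single_right] using h2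
  have hall := ae_all_iff.2 hae
  obtain ⟨v, hv⟩ := hall.exists
  have h1 : (v : Vec d) = 0 := by ext i; exact hv i
  have h2 : ‖(v : Vec d)‖ = 1 := by simp
  rw [h1, norm_zero] at h2
  exact zero_ne_one h2

/-- In dimension one, the spherical moment does not depend on the spherical measure. -/
lemma sphereMoment_single_one {spec' : Measure (USphere 1)} [IsProbabilityMeasure spec'] :
    sphereMoment α spec' (EuclideanSpace.single 0 1) = 1 := by
  have : ∀ v : USphere 1, |⟪(v : Vec 1), (EuclideanSpace.single 0 1 : Vec 1)⟫| = 1 := by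
    intro v
    have h2 : ‖(v : Vec 1)‖ = 1 := by simp
    rw [EuclideanSpace.norm_eq] at h2
    simpa [EuclideanSpace.inner_single_right, Real.sqrt_sq_eq_abs] using h2
  simp [sphereMoment, this]

end Exponent

section Factorization

/-! ### Factorization of the exponent in the three settings -/

variable {d : ℕ}

/-- Along the discounted exposures of the admissible controls, the characteristic exponent of the
driving process is `Q κ`, where `κ` is the exponent of the reference law `ν` and is homogeneous of
degree `α`; moreover `Q ^ (1 / α)` is the weight `w`, and every multiple `W` of the reference
variable has the law of some linear functional of the driving process. -/
structure IsFactorization [NeZero d] (K : Market d) (ν : Measure ℝ) (Q : Vec d → ℝ)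
    (κ : ℝ → ℂ) : Prop where
  continuous : Continuous Q
  nonneg : ∀ y, 0 ≤ Q y
  exponent : ∀ u ∈ K.controlSet, ∀ s ∈ Icc (0 : ℝ) K.T, ∀ ξ : ℝ,
    stableExponent K.α K.c K.spec K.R (ξ • discountedExposure K u s)
      = Q (discountedExposure K u s) * κ ξ
  homogeneous : ∀ W : ℝ, 0 ≤ W → ∀ ξ, κ (W * ξ) = ((W ^ K.α : ℝ) : ℂ) * κ ξ
  charFun_eq : ∀ ξ, charFun ν ξ = Complex.exp (κ ξ)
  weight_eq : ∀ v ∈ K.detAdmissible, ∀ s ∈ Ioc (0 : ℝ) K.T,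
    K.w v s = Q (discountedExposure K (step v s) s) ^ K.α⁻¹
  exists_functional : ∀ W : ℝ, 0 ≤ W → ∃ b : Vec d, ∀ ξ : ℝ,
    stableExponent K.α K.c K.spec K.R (ξ • b) = ((W ^ K.α : ℝ) : ℂ) * κ ξ

lemma inner_single_zero [NeZero d] (y : Vec d) :
    ⟪(EuclideanSpace.single 0 1 : Vec d), y⟫ = y 0 := by
  simp [EuclideanSpace.inner_single_left]

lemma discountedExposure_apply (K : Market d) (u : Vec d) (s : ℝ) (i : Fin d) :
    discountedExposure K u s i
      = Real.exp (K.r * (K.T - s)) * Matrix.vecMul u.ofLp (K.σ s) i := by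
  simp [discountedExposure, Market.exposure]

variable {Ω Ω' : Type*} [MeasurableSpace Ω] [MeasurableSpace Ω'] {P : Measure Ω}
  {L : ℝ≥0 → Ω → Vec d} {P' : Measure Ω'} {Ls : ℝ≥0 → Ω' → Vec 1}

lemma IsStableLevy.charFun_coord [NeZero d] {α c : ℝ} {spec : Measure (USphere d)}
    {R : Matrix (Fin d) (Fin d) ℝ} (hL : IsStableLevy P α c spec R L) (ξ : ℝ) :
    charFun (P.map fun ω => L 1 ω 0) ξ
      = Complex.exp (stableExponent α c spec R (ξ • EuclideanSpace.single 0 1)) := by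
  have := hL.charFun_inner 1 (EuclideanSpace.single 0 1) ξ
  simpa only [inner_single_zero, NNReal.coe_one, Complex.ofReal_one, one_mul] using this

/-- The symmetric non-Gaussian case. The exponents of the driving process and of the
one-dimensional symmetric process are multiples of the same real number, as both have the same
constant `c`. -/
lemma isFactorization_symmetric [NeZero d] (K : Market d)
    (hL : IsStableLevy P K.α K.c K.spec K.R L) (hα : K.α < 2) (hset : K.setting = .symmetric)
    (hs : IsSymmetric P L) {spec' : Measure (USphere 1)} [IsProbabilityMeasure spec']
    (hLs : IsStableLevy P' K.α K.c spec' 1 Ls) (hLs_symm : IsSymmetric P' Ls) :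
    IsFactorization K (K.lhatLaw P L P' Ls) (sphereMoment K.α K.spec)
      (fun ξ => ((|ξ| ^ K.α * (radialExponent K.α K.c 1).re : ℝ) : ℂ)) := by
  have := K.spec_prob
  have h1 := K.α_gt
  have h0 : 0 < K.α := by linarith
  refine ⟨continuous_sphereMoment h0, sphereMoment_nonneg, ?_, ?_, ?_, ?_, ?_⟩
  · intro u _ s _ ξ
    rw [hL.exponent_symmetric h1 hα K.c_pos hs, sphereMoment_smul]
    push_cast
    ring
  · intro W hW ξ
    rw [abs_mul, abs_of_nonneg hW, Real.mul_rpow hW (abs_nonneg _)]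
    push_cast
    ring
  · intro ξ
    have hlaw : K.lhatLaw P L P' Ls = P'.map (fun ω => Ls 1 ω 0) := by
      simp [Market.lhatLaw, hα, hset]
    rw [hlaw, hLs.charFun_coord, hLs.exponent_symmetric h1 hα K.c_pos hLs_symm,
      sphereMoment_smul, sphereMoment_single_one]
    push_cast
    ring_nf
  · intro v _ s _
    have hw : K.w v s = lpNorm (fun y : USphere d =>
            dotProduct (K.exposure (step v s) s).ofLp (y : Vec d).ofLp
              * Real.exp (K.r * (K.T - s)))
          (ENNReal.ofReal K.α) K.spec := by
      simp [Market.w, hα, hset]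
    have hfun : (fun y : USphere d => dotProduct (K.exposure (step v s) s).ofLp (y : Vec d).ofLp
              * Real.exp (K.r * (K.T - s)))
        = fun y : USphere d => ⟪(y : Vec d), discountedExposure K (step v s) s⟫ := by
      funext y
      rw [discountedExposure, real_inner_smul_right, EuclideanSpace.inner_eq_star_dotProduct]
      simp [mul_comm]
    rw [hw, hfun, lpNorm_eq_integral_norm_rpow_toReal (by simpa using h0) ENNReal.ofReal_ne_top
      (by fun_prop), ENNReal.toReal_ofReal h0.le]
    rfl
  · intro W hW
    obtain ⟨y, hy⟩ := exists_sphereMoment_pos (spec := K.spec) h0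
    set q := sphereMoment K.α K.spec y with hq
    refine ⟨(W / q ^ K.α⁻¹) • y, fun ξ => ?_⟩
    have hq' : 0 < q ^ K.α⁻¹ := Real.rpow_pos_of_pos hy _
    rw [hL.exponent_symmetric h1 hα K.c_pos hs, sphereMoment_smul, sphereMoment_smul,
      abs_of_nonneg (div_nonneg hW hq'.le), Real.div_rpow hW hq'.le, ← Real.rpow_mul hy.le,
      inv_mul_cancel₀ h0.ne', Real.rpow_one, ← hq, div_mul_cancel₀ _ hy.ne']
    push_cast
    ring

/-- The one-dimensional non-Gaussian case without short selling. The exponent need not be real here;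
it factorizes since the exposures are non-negative and the exponent is homogeneous under
non-negative factors. -/
lemma isFactorization_longOnly [NeZero d] (K : Market d)
    (hL : IsStableLevy P K.α K.c K.spec K.R L) (hα : K.α < 2) (hset : K.setting = .longOnly)
    (hd : d = 1) :
    IsFactorization K (K.lhatLaw P L P' Ls) (fun y => |y 0| ^ K.α)
      (fun ξ => stableExponent K.α K.c K.spec K.R (ξ • EuclideanSpace.single 0 1)) := by
  have := K.spec_prob
  have h1 := K.α_gt
  have h0 : 0 < K.α := by linarith
  have hsub : ∀ i : Fin d, i = 0 := fun i => by
    have : Subsingleton (Fin d) := by subst hd; infer_instance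
    exact Subsingleton.elim _ _
  have hcoord : ∀ u s, discountedExposure K u s 0
      = u 0 * K.σ s 0 0 * Real.exp (K.r * (K.T - s)) := by
    intro u s
    rw [discountedExposure_apply, Matrix.vecMul, dotProduct,
      Finset.sum_eq_single 0 (fun i _ hi => absurd (hsub i) hi) (by simp)]
    ring
  have hcpos : ∀ u ∈ K.controlSet, ∀ s ∈ Icc (0 : ℝ) K.T, 0 ≤ discountedExposure K u s 0 := by
    intro u hu s hs
    have hu' : ∀ i, 0 ≤ u i ∧ u i ≤ K.M := by simpa [Market.controlSet, hset] using hu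
    rw [hcoord]
    have := K.σ_pos s hs 0 0
    have := (hu' 0).1
    positivity
  have hline : ∀ {y : Vec d}, ∀ ξ : ℝ, ξ • y = y 0 • (ξ • (EuclideanSpace.single 0 1 : Vec d)) := by
    intro y ξ
    ext i
    rw [hsub i]
    simp [mul_comm]
  refine ⟨?_, fun y => by positivity, ?_, ?_, ?_, ?_, ?_⟩
  · have : Continuous fun y : Vec d => |y 0| := by fun_prop
    exact this.rpow_const fun _ => Or.inr h0.le
  · intro u hu s hs ξ
    have hp := hcpos u hu s hs
    rw [hline ξ, stableExponent_smul h1 hα K.c_pos hp, abs_of_nonneg hp]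
  · intro W hW ξ
    rw [← smul_smul, stableExponent_smul h1 hα K.c_pos hW]
  · intro ξ
    have hlaw : K.lhatLaw P L P' Ls = P.map (fun ω => L 1 ω 0) := by
      simp [Market.lhatLaw, hα, hset]
    rw [hlaw, hL.charFun_coord]
  · intro v hv s hs
    have hp := hcpos (step v s) (hv _) s ⟨hs.1.le, hs.2⟩
    have hw : K.w v s = step v s 0 * K.σ s 0 0 * Real.exp (K.r * (K.T - s)) := by
      simp [Market.w, hα, hset]
    rw [hw, ← hcoord, abs_of_nonneg hp, ← Real.rpow_mul hp, mul_inv_cancel₀ h0.ne', Real.rpow_one]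
  · intro W hW
    refine ⟨W • EuclideanSpace.single 0 1, fun ξ => ?_⟩
    rw [smul_comm, stableExponent_smul h1 hα K.c_pos hW]

/-- The Gaussian case. -/
lemma isFactorization_gaussian [NeZero d] (K : Market d)
    (hL : IsStableLevy P K.α K.c K.spec K.R L) (hα : K.α = 2) :
    IsFactorization K (K.lhatLaw P L P' Ls)
      (fun y => dotProduct y.ofLp (K.R.mulVec y.ofLp)) (fun ξ => ((-ξ ^ 2 / 2 : ℝ) : ℂ)) := by
  obtain ⟨hR, hR1⟩ := K.R_corr hα
  have hlt : ¬ K.α < 2 := by linarith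
  have hsm : ∀ (ξ : ℝ) (y : Vec d), dotProduct (ξ • y).ofLp (K.R.mulVec (ξ • y).ofLp)
      = ξ ^ 2 * dotProduct y.ofLp (K.R.mulVec y.ofLp) := by
    intro ξ y
    simp only [WithLp.ofLp_smul, Matrix.mulVec_smul, smul_dotProduct, dotProduct_smul, smul_eq_mul]
    ring
  have hψ : ∀ (ξ : ℝ) (y : Vec d), stableExponent K.α K.c K.spec K.R (ξ • y)
      = ((dotProduct y.ofLp (K.R.mulVec y.ofLp) : ℝ) : ℂ) * ((-ξ ^ 2 / 2 : ℝ) : ℂ) := by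
    intro ξ y
    rw [stableExponent, if_neg hlt, hsm]
    push_cast
    ring
  have hsingle : dotProduct (EuclideanSpace.single 0 1 : Vec d).ofLp
      (K.R.mulVec (EuclideanSpace.single 0 1 : Vec d).ofLp) = 1 := by
    simp [hR1]
  have hW2 : ∀ W : ℝ, W ^ K.α = W ^ 2 := fun W => by rw [hα]; exact Real.rpow_two W
  have hnonneg : ∀ y : Vec d, 0 ≤ dotProduct y.ofLp (K.R.mulVec y.ofLp) := fun y => by
    simpa using hR.posSemidef.dotProduct_mulVec_nonneg y.ofLp
  refine ⟨?_, hnonneg, fun u _ s _ ξ => hψ ξ _, ?_, ?_, ?_, ?_⟩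
  · fun_prop
  · intro W _ ξ
    rw [hW2]
    push_cast
    ring
  · intro ξ
    have hlaw : K.lhatLaw P L P' Ls = P.map (fun ω => L 1 ω 0) := by
      simp [Market.lhatLaw, hlt]
    rw [hlaw, hL.charFun_coord, hψ, hsingle]
    simp
  · intro v _ s _
    have hw : K.w v s = √(dotProduct (K.exposure (step v s) s).ofLp
        (K.R.mulVec (K.exposure (step v s) s).ofLp)) * Real.exp (K.r * (K.T - s)) := by
      simp [Market.w, hlt]
    have he := (Real.exp_pos (K.r * (K.T - s))).le
    rw [hw, discountedExposure, hsm, hα, show (2 : ℝ)⁻¹ = 1 / 2 by norm_num, ← Real.sqrt_eq_rpow,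
      Real.sqrt_mul (sq_nonneg _), Real.sqrt_sq he, mul_comm]
  · intro W _
    refine ⟨W • EuclideanSpace.single 0 1, fun ξ => ?_⟩
    rw [hψ, hsm, hsingle, hW2, mul_one]

/-- The characteristic exponent factorizes in all settings. -/
lemma exists_isFactorization [NeZero d] (K : Market d)
    (hL : IsStableLevy P K.α K.c K.spec K.R L) (hsetting : K.SettingHolds P L)
    {spec' : Measure (USphere 1)} [IsProbabilityMeasure spec']
    (hLs : IsStableLevy P' K.α K.c spec' 1 Ls) (hLs_symm : IsSymmetric P' Ls) :
    ∃ Q κ, IsFactorization K (K.lhatLaw P L P' Ls) Q κ := by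
  rcases K.α_le.lt_or_eq with hα | hα
  · cases hset : K.setting with
    | symmetric =>
      have hs : IsSymmetric P L := by simpa [Market.SettingHolds, hset] using hsetting
      exact ⟨_, _, isFactorization_symmetric K hL hα hset hs hLs hLs_symm⟩
    | longOnly =>
      have hd : d = 1 := by simpa [Market.SettingHolds, hset] using hsetting
      exact ⟨_, _, isFactorization_longOnly K hL hα hset hd⟩
  · exact ⟨_, _, isFactorization_gaussian K hL hα⟩

lemma isProbabilityMeasure_lhatLaw [NeZero d] [IsProbabilityMeasure P] [IsProbabilityMeasure P']
    (K : Market d) (hL : ∀ t, Measurable (L t)) (hLs : ∀ t, Measurable (Ls t)) :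
    IsProbabilityMeasure (K.lhatLaw P L P' Ls) := by
  have h1 : IsProbabilityMeasure (P.map fun ω => L 1 ω 0) :=
    Measure.isProbabilityMeasure_map (by have := hL 1; fun_prop)
  have h2 : IsProbabilityMeasure (P'.map fun ω => Ls 1 ω 0) :=
    Measure.isProbabilityMeasure_map (by have := hLs 1; fun_prop)
  unfold Market.lhatLaw
  split_ifs
  · cases K.setting <;> assumption
  · exact h1

end Factorization

section GainLaw

/-! ### The law of the gain -/

variable {d : ℕ} (K : Market d)

/-- The deterministic part `∫_n^T e^{r (T - s)} uᵀ (μ_s - r) ds` of the discounted gain. -/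
noncomputable def drift (v : ℕ → Vec d) (n : ℕ) : ℝ :=
  ∫ s in (n : ℝ)..K.T, Real.exp (K.r * (K.T - s)) * K.excess (step v s) s

variable {K}

lemma drift_horizon (v : ℕ → Vec d) : drift K v K.T = 0 := intervalIntegral.integral_same

lemma step_congr {v v' : ℕ → Vec d} {n : ℕ} (h : ∀ k, n ≤ k → v k = v' k) {s : ℝ}
    (hs : (n : ℝ) < s) : step v s = step v' s := by
  have : n < ⌈s⌉₊ := Nat.lt_ceil.2 hs
  exact h _ (by omega)

lemma drift_congr {v v' : ℕ → Vec d} {n : ℕ} (hn : n ≤ K.T) (h : ∀ k, n ≤ k → v k = v' k) :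
    drift K v n = drift K v' n := by
  refine intervalIntegral.integral_congr_ae (Eventually.of_forall fun s hs => ?_)
  rw [uIoc_of_le (by exact_mod_cast hn)] at hs
  simp only [step_congr h hs.1]

lemma det_mem_admissible {v : ℕ → Vec d} (hv : v ∈ K.detAdmissible) : det v ∈ K.admissible :=
  fun k => ⟨measurable_const, fun _ => hv k⟩

lemma measurable_gain {Ω : Type*} [MeasurableSpace Ω] {P : Measure Ω} {L : ℝ≥0 → Ω → Vec d}
    {X : ℕ → ℝ → ControlLaw d → ℝ → Ω → ℝ} {u : ControlLaw d} {n : ℕ} (hn : n ≤ K.T) {x : ℝ}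
    (hX : K.IsWealth P L n x u (X n x u)) : Measurable (K.gain X u n x) :=
  (hX.measurable _ ⟨by exact_mod_cast hn, le_rfl⟩).sub_const _

lemma ae_gain_eq {Ω : Type*} [MeasurableSpace Ω] {P : Measure Ω} {L : ℝ≥0 → Ω → Vec d}
    {X : ℕ → ℝ → ControlLaw d → ℝ → Ω → ℝ} {u : ControlLaw d} {n : ℕ} (hn : n ≤ K.T) {x : ℝ}
    (hX : K.IsWealth P L n x u (X n x u)) :
    ∀ᵐ ω ∂P, K.gain X u n x ω
      = X n x u K.T ω - Real.exp (K.r * (K.T - n)) * X n x u n ω := by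
  filter_upwards [hX.ae_initial hn] with ω hω
  rw [hω, Market.gain]
  ring

variable [NeZero d] (K)

/-- The scale `‖w(u)‖_{L^α((n, T])}` of the random part of the discounted gain. -/
noncomputable def weight (v : ℕ → Vec d) (n : ℕ) : ℝ :=
  lpNorm (K.w v) (ENNReal.ofReal K.α) (volume.restrict (Ioc (n : ℝ) K.T))

/-- The law of `weight * Y + drift` for a random variable `Y` with law `ν`. -/
noncomputable def gainLaw (ν : Measure ℝ) (v : ℕ → Vec d) (n : ℕ) : Measure ℝ :=
  ν.map fun y => weight K v n * y + drift K v n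

variable {K}

lemma weight_nonneg (v : ℕ → Vec d) (n : ℕ) : 0 ≤ weight K v n := lpNorm_nonneg

lemma weight_horizon (v : ℕ → Vec d) : weight K v K.T = 0 := by simp [weight]

lemma gainLaw_horizon (ν : Measure ℝ) [IsProbabilityMeasure ν] (v : ℕ → Vec d) :
    gainLaw K ν v K.T = Measure.dirac 0 := by
  simp [gainLaw, drift_horizon, weight_horizon]

variable {ν : Measure ℝ} {Q : Vec d → ℝ} {κ : ℝ → ℂ}

lemma IsFactorization.weight_eq_integral (hF : IsFactorization K ν Q κ) {v : ℕ → Vec d}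
    (hv : v ∈ K.detAdmissible) {n : ℕ} (hn : n ≤ K.T) :
    weight K v n = (∫ s in (n : ℝ)..K.T, Q (discountedExposure K (step v s) s)) ^ K.α⁻¹ := by
  have h0 : 0 < K.α := by linarith [K.α_gt]
  have hn' : (n : ℝ) ≤ K.T := by exact_mod_cast hn
  have hsub : Ioc (n : ℝ) K.T ⊆ Ioc 0 (K.T : ℝ) := Ioc_subset_Ioc_left n.cast_nonneg
  have hmeas : AEStronglyMeasurable (K.w v) (volume.restrict (Ioc (n : ℝ) K.T)) := by
    have h := aestronglyMeasurable_period
      (g := fun k s => Q (discountedExposure K (v k) s) ^ K.α⁻¹) (T := K.T)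
      (fun k => (hF.continuous.comp_continuousOn (continuousOn_discountedExposure K _)).rpow_const
        fun _ _ => Or.inr (inv_nonneg.2 h0.le)) 0
    refine (h.mono_measure (Measure.restrict_mono (hsub.trans Ioc_subset_Icc_self) le_rfl)).congr ?_
    filter_upwards [ae_restrict_mem measurableSet_Ioc] with s hs
    rw [hF.weight_eq v hv s (hsub hs)]
    simp [period, step]
  rw [weight, lpNorm_eq_integral_norm_rpow_toReal (by simpa using h0) ENNReal.ofReal_ne_top hmeas,
    ENNReal.toReal_ofReal h0.le, intervalIntegral.integral_of_le hn']
  congr 1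
  refine setIntegral_congr_fun measurableSet_Ioc fun s hs => ?_
  have hq := hF.nonneg (discountedExposure K (step v s) s)
  simp only [hF.weight_eq v hv s (hsub hs)]
  rw [Real.norm_of_nonneg (Real.rpow_nonneg hq _), ← Real.rpow_mul hq, inv_mul_cancel₀ h0.ne',
    Real.rpow_one]

lemma IsFactorization.weight_rpow (hF : IsFactorization K ν Q κ) {v : ℕ → Vec d}
    (hv : v ∈ K.detAdmissible) {n : ℕ} (hn : n ≤ K.T) :
    weight K v n ^ K.α = ∫ s in (n : ℝ)..K.T, Q (discountedExposure K (step v s) s) := by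
  have h0 : 0 < K.α := by linarith [K.α_gt]
  have hn' : (n : ℝ) ≤ K.T := by exact_mod_cast hn
  rw [hF.weight_eq_integral hv hn, ← Real.rpow_mul
    (intervalIntegral.integral_nonneg hn' fun s _ => hF.nonneg _), inv_mul_cancel₀ h0.ne',
    Real.rpow_one]

lemma IsFactorization.weight_congr (hF : IsFactorization K ν Q κ) {v v' : ℕ → Vec d}
    (hv : v ∈ K.detAdmissible) (hv' : v' ∈ K.detAdmissible) {n : ℕ} (hn : n ≤ K.T)
    (h : ∀ k, n ≤ k → v k = v' k) : weight K v n = weight K v' n := by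
  rw [hF.weight_eq_integral hv hn, hF.weight_eq_integral hv' hn]
  congr 1
  refine intervalIntegral.integral_congr_ae (Eventually.of_forall fun s hs => ?_)
  rw [uIoc_of_le (by exact_mod_cast hn)] at hs
  simp only [step_congr h hs.1]

lemma IsFactorization.gainLaw_congr (hF : IsFactorization K ν Q κ) {v v' : ℕ → Vec d}
    (hv : v ∈ K.detAdmissible) (hv' : v' ∈ K.detAdmissible) {n : ℕ} (hn : n ≤ K.T)
    (h : ∀ k, n ≤ k → v k = v' k) : gainLaw K ν v n = gainLaw K ν v' n := by
  simp only [gainLaw, hF.weight_congr hv hv' hn h, drift_congr hn h]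

lemma IsFactorization.charFun_scaled (hF : IsFactorization K ν Q κ) {W : ℝ} (hW : 0 ≤ W)
    (a ξ : ℝ) : charFun (ν.map fun y => W * y + a) ξ
      = Complex.exp (((ξ * a : ℝ) : ℂ) * Complex.I)
        * Complex.exp (((W ^ K.α : ℝ) : ℂ) * κ ξ) := by
  rw [← hF.homogeneous W hW, ← hF.charFun_eq, charFun_apply_real, charFun_apply_real,
    integral_map (by fun_prop) (by fun_prop), ← integral_const_mul]
  refine integral_congr_ae (Eventually.of_forall fun y => ?_)
  simp only
  rw [← Complex.exp_add]
  congr 1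
  push_cast
  ring

variable {Ω : Type*} [MeasurableSpace Ω] {P : Measure Ω} [IsProbabilityMeasure P]
  {L : ℝ≥0 → Ω → Vec d}

/-- The law of the discounted gain over `[m, T]` under a deterministic control. -/
lemma Market.IsWealth.map_gain [IsProbabilityMeasure ν] (hF : IsFactorization K ν Q κ)
    (hL : IsStableLevy P K.α K.c K.spec K.R L) {n m : ℕ} (hnT : n < K.T) (hnm : n ≤ m)
    (hmT : m ≤ K.T) {x : ℝ} {v : ℕ → Vec d} (hv : v ∈ K.detAdmissible) {X : ℝ → Ω → ℝ}
    (hX : K.IsWealth P L n x (det v) X) :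
    P.map (fun ω => X K.T ω - Real.exp (K.r * (K.T - m)) * X m ω) = gainLaw K ν v m := by
  have hnm' : (n : ℝ) ≤ m := by exact_mod_cast hnm
  have hmT' : (m : ℝ) ≤ K.T := by exact_mod_cast hmT
  have hmeas : Measurable fun ω => X K.T ω - Real.exp (K.r * (K.T - m)) * X m ω :=
    (hX.measurable _ ⟨hnm'.trans hmT', le_rfl⟩).sub
      ((hX.measurable _ ⟨hnm', hmT'⟩).const_mul _)
  have h1 : IsProbabilityMeasure (P.map fun ω => X K.T ω - Real.exp (K.r * (K.T - m)) * X m ω) :=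
    Measure.isProbabilityMeasure_map hmeas.aemeasurable
  have h2 : IsProbabilityMeasure (gainLaw K ν v m) :=
    Measure.isProbabilityMeasure_map (by fun_prop)
  refine Measure.ext_of_charFun (funext fun ξ => ?_)
  rw [gainLaw, hF.charFun_scaled (weight_nonneg v m), hF.weight_rpow hv hmT,
    hX.charFun_gain hL hnT hnm hmT hF.continuous
      (fun s hs k => hF.exponent _ (hv k) s hs ξ)]
  rfl

variable {X : ℕ → ℝ → ControlLaw d → ℝ → Ω → ℝ}

/-- The law of the gain does not depend on the initial wealth. -/
lemma map_gain [IsProbabilityMeasure ν] (hF : IsFactorization K ν Q κ)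
    (hL : IsStableLevy P K.α K.c K.spec K.R L) {v : ℕ → Vec d} (hv : v ∈ K.detAdmissible) {n : ℕ}
    (hn : n ≤ K.T) {x : ℝ} (hX : K.IsWealth P L n x (det v) (X n x (det v))) :
    P.map (K.gain X (det v) n x) = gainLaw K ν v n := by
  rw [Measure.map_congr (ae_gain_eq hn hX)]
  rcases hn.lt_or_eq with h | rfl
  · exact hX.map_gain hF hL h le_rfl hn hv
  · simp [gainLaw_horizon]

/-- Rewards are integrable under the law of the gain: up to the drift, the gain has the law of a
linear functional of `L_1`. -/
lemma IsFactorization.integrable_rew [IsProbabilityMeasure ν] (hF : IsFactorization K ν Q κ)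
    (hL : IsStableLevy P K.α K.c K.spec K.R L)
    (hrew : ∀ (a : ℝ) (b : Vec d) (t : ℝ≥0), 0 < t → t ≤ K.T →
      Integrable (fun ω => K.rew (a + ⟪b, L t ω⟫)) P)
    (v : ℕ → Vec d) {n : ℕ} (hn : n ≤ K.T) : Integrable K.rew (gainLaw K ν v n) := by
  have hcont : Continuous K.rew := K.rew_smooth.continuous
  rcases hn.lt_or_eq with h | rfl
  · have hT : (1 : ℝ≥0) ≤ K.T := by exact_mod_cast (by omega : 1 ≤ K.T)
    obtain ⟨b, hb⟩ := hF.exists_functional (weight K v n) (weight_nonneg v n)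
    have hmeas : Measurable fun ω => ⟪b, L 1 ω⟫ :=
      Measurable.inner measurable_const (hL.measurable 1)
    have h1 : IsProbabilityMeasure (P.map fun ω => ⟪b, L 1 ω⟫) :=
      Measure.isProbabilityMeasure_map hmeas.aemeasurable
    have h2 : IsProbabilityMeasure (ν.map fun y => weight K v n * y + 0) :=
      Measure.isProbabilityMeasure_map (by fun_prop)
    have hlaw : P.map (fun ω => ⟪b, L 1 ω⟫) = ν.map fun y => weight K v n * y + 0 := by
      refine Measure.ext_of_charFun (funext fun ξ => ?_)
      rw [hF.charFun_scaled (weight_nonneg v n), hL.charFun_inner, hb]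
      simp
    have hi := hrew (drift K v n) b 1 zero_lt_one hT
    have hi2 : Integrable (fun y => K.rew (drift K v n + y)) (P.map fun ω => ⟪b, L 1 ω⟫) :=
      (integrable_map_measure (by fun_prop) hmeas.aemeasurable).2 hi
    rw [hlaw, integrable_map_measure (by fun_prop) (by fun_prop)] at hi2
    rw [gainLaw, integrable_map_measure (by fun_prop) (by fun_prop)]
    refine hi2.congr (Eventually.of_forall fun y => ?_)
    simp only [Function.comp_apply]
    congr 1
    ring
  · rw [gainLaw_horizon]
    exact integrable_dirac (by simp)

end GainLaw

section RiskOfGain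

/-! ### The risk of the gain -/

variable {d : ℕ} {Ω : Type*} [MeasurableSpace Ω] {P : Measure Ω} {L : ℝ≥0 → Ω → Vec d}

lemma RiskMeasure.ofLaw_map {T : ℝ≥0} {α : ℝ} (ρ : RiskMeasure P L T α) {Y : Ω → ℝ}
    (hY : Y ∈ ρ.carrier) : ρ.ofLaw (P.map Y) = ρ.val Y := by
  refine le_antisymm (iInf₂_le Y ⟨hY, rfl⟩) (le_iInf₂ fun Y' hY' => ?_)
  refine (ρ.law_invariant Y hY Y' hY'.1 ⟨?_, ?_, hY'.2.symm⟩).le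
  · exact (ρ.measurable_of_mem Y hY).aemeasurable
  · exact (ρ.measurable_of_mem Y' hY'.1).aemeasurable

/-- A finite risk of a law is attained: if no element of the domain has that law, the infimum that
defines the risk is `⊤`. -/
lemma RiskMeasure.exists_of_ofLaw_eq {T : ℝ≥0} {α : ℝ} (ρ : RiskMeasure P L T α) {ν : Measure ℝ}
    {a : ℝ} (h : ρ.ofLaw ν = (a : EReal)) :
    ∃ Y ∈ ρ.carrier, P.map Y = ν ∧ ρ.val Y = (a : EReal) := by
  by_contra! hcon
  by_cases hex : ∃ Y ∈ ρ.carrier, P.map Y = ν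
  · obtain ⟨Y, hY, rfl⟩ := hex
    exact hcon Y hY rfl ((ρ.ofLaw_map hY).symm.trans h)
  · have : ρ.ofLaw ν = ⊤ := by
      unfold RiskMeasure.ofLaw
      simp only [iInf_eq_top]
      exact fun Y hY => absurd ⟨Y, hY.1, hY.2⟩ hex
    rw [this] at h
    exact EReal.coe_ne_top a h.symm

variable [NeZero d] {K : Market d}

/-- The risk of the gain, from positive homogeneity and cash- or shift-invariance. -/
lemma ofLaw_gainLaw (ρ : RiskMeasure P L K.T K.α) {ν : Measure ℝ} {ϱ : ℝ}
    (hϱ : ρ.ofLaw ν = (ϱ : EReal)) (v : ℕ → Vec d) (n : ℕ) :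
    ρ.ofLaw (gainLaw K ν v n) = (K.riskFormula ρ ϱ v n : EReal) := by
  obtain ⟨Y, hY, rfl, hval⟩ := ρ.exists_of_ofLaw_eq hϱ
  set W := weight K v n with hW
  have hW0 : 0 ≤ W := weight_nonneg v n
  have h1 := ρ.smul_mem Y hY W hW0
  have h2 := ρ.add_const_mem _ h1 (drift K v n)
  have hm := ρ.measurable_of_mem Y hY
  have hlaw : gainLaw K (P.map Y) v n = P.map fun ω => W * Y ω + drift K v n := by
    rw [gainLaw, Measure.map_map (by fun_prop) hm]
    rfl
  have hsm : ρ.val (fun ω => W * Y ω) = ((W * ϱ : ℝ) : EReal) := by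
    rw [ρ.pos_homogeneous Y hY W hW0, hval, EReal.coe_mul]
  rw [hlaw, ρ.ofLaw_map h2]
  by_cases hc : ρ.CashInvariant
  · have hi : ∫ s in (n : ℝ)..K.T, K.m ρ v s = drift K v n := by
      refine intervalIntegral.integral_congr fun s _ => ?_
      simp only [Market.m, if_pos hc]
      ring
    rw [hc _ h1, hsm, ← EReal.coe_sub, Market.riskFormula, hi]
    congr 1
    rw [← weight, ← hW]
    ring
  · have hi : ∫ s in (n : ℝ)..K.T, K.m ρ v s = 0 := by
      simp only [Market.m, if_neg hc, intervalIntegral.integral_zero]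
    rw [ρ.cash_or_shift.resolve_left hc _ h1, hsm, Market.riskFormula, hi]
    congr 1
    rw [← weight, ← hW]
    ring

lemma riskFormula_horizon (ρ : RiskMeasure P L K.T K.α) (ϱ : ℝ) (v : ℕ → Vec d) :
    K.riskFormula ρ ϱ v K.T = 0 := by
  simp [Market.riskFormula]

lemma IsFactorization.riskFormula_congr {ν : Measure ℝ} {Q : Vec d → ℝ} {κ : ℝ → ℂ}
    (hF : IsFactorization K ν Q κ) (ρ : RiskMeasure P L K.T K.α) {ϱ : ℝ}
    (hϱ : ρ.ofLaw ν = (ϱ : EReal)) {v v' : ℕ → Vec d}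
    (hv : v ∈ K.detAdmissible) (hv' : v' ∈ K.detAdmissible) {n : ℕ} (hn : n ≤ K.T)
    (h : ∀ k, n ≤ k → v k = v' k) : K.riskFormula ρ ϱ v n = K.riskFormula ρ ϱ v' n := by
  have := (ofLaw_gainLaw ρ hϱ v n).symm.trans
    ((congrArg ρ.ofLaw (hF.gainLaw_congr hv hv' hn h)).trans (ofLaw_gainLaw ρ hϱ v' n))
  exact_mod_cast this

end RiskOfGain

section Deviation

/-! ### The extended HJB equation -/

variable {d : ℕ}

lemma deviate_det (û v : ℕ → Vec d) (n : ℕ) :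
    deviate (det û) (det v) n = det (Function.update û n (v n)) := by
  funext k y
  by_cases h : k = n
  · subst h; simp [deviate, det]
  · simp [deviate, det, h]

/-- If the next value function is constant in the wealth, the law of the wealth is irrelevant. -/
lemma generator_of_const {Ω : Type*} [MeasurableSpace Ω] {P : Measure Ω} [IsProbabilityMeasure P]
    {X : ℕ → ℝ → ControlLaw d → ℝ → Ω → ℝ} {u : ControlLaw d} {f : ℕ → ℝ → ℝ} {n : ℕ} {c : ℝ}
    (hf : ∀ y, f (n + 1) y = c) (x : ℝ) :
    GeneratorExists P X u f n x ∧ generator P X u f n x = c - f n x := by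
  simp [GeneratorExists, generator, hf]

end Deviation

end MeanRisk

open MeanRisk in
theorem theorem4p7 {d : ℕ} [NeZero d] (K : MeanRisk.Market d)
    {Ω : Type*} [MeasurableSpace Ω] (P : Measure Ω) [IsProbabilityMeasure P]
    (L : ℝ≥0 → Ω → MeanRisk.Vec d)
    (hL : MeanRisk.IsStableLevy P K.α K.c K.spec K.R L)
    (hsetting : K.SettingHolds P L)
    -- the symmetric one-dimensional stable process with the same constant `c`
    {Ω' : Type*} [MeasurableSpace Ω'] (P' : Measure Ω') [IsProbabilityMeasure P']
    (Ls : ℝ≥0 → Ω' → MeanRisk.Vec 1)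
    (spec' : Measure (MeanRisk.USphere 1)) [IsProbabilityMeasure spec']
    (hLs : MeanRisk.IsStableLevy P' K.α K.c spec' 1 Ls)
    (hLs_symm : MeanRisk.IsSymmetric P' Ls)
    -- integrability of the rewards
    (hrew : ∀ (a : ℝ) (b : MeanRisk.Vec d) (t : ℝ≥0), 0 < t → t ≤ K.T →
      Integrable (fun ω => K.rew (a + ⟪b, L t ω⟫)) P)
    -- the risk measure, with finite value `ϱ` at `L̂_1`
    (ρ : MeanRisk.RiskMeasure P L K.T K.α)
    (ϱ : ℝ) (hϱ : ρ.ofLaw (K.lhatLaw P L P' Ls) = (ϱ : EReal))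
    -- the wealth processes started at time `n` in `x` under the control law `u`
    (X : ℕ → ℝ → MeanRisk.ControlLaw d → ℝ → Ω → ℝ)
    (hX : ∀ n ≤ K.T, ∀ x, ∀ u ∈ K.admissible, K.IsWealth P L n x u (X n x u))
    -- a deterministic equilibrium control law
    (û : ℕ → MeanRisk.Vec d)
    (hû : K.IsEquilibrium ρ X (MeanRisk.det û)) :
    -- well-posedness
    (∀ v ∈ K.detAdmissible, ∀ n ≤ K.T, ∀ x,
      Integrable (fun ω => K.rew (K.gain X (MeanRisk.det v) n x ω)) P ∧
      K.riskVal ρ X (MeanRisk.det v) n x ≠ ⊤ ∧ K.riskVal ρ X (MeanRisk.det v) n x ≠ ⊥) ∧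
    (∀ v ∈ K.detAdmissible, ∀ n < K.T, ∀ x,
      let u := MeanRisk.deviate (MeanRisk.det û) (MeanRisk.det v) n
      MeanRisk.GeneratorExists P X u (K.J ρ X (MeanRisk.det û)) n x ∧
      MeanRisk.GeneratorExists P X u (K.rewardFn P X u) n x ∧
      MeanRisk.GeneratorExists P X u (K.riskFn ρ X u) n x) ∧
    -- the extended HJB equation, with the supremum attained at `û`
    (∀ n < K.T, ∀ x,
      IsLUB ((fun v => MeanRisk.hjbTerm K ρ X (MeanRisk.det û)
          (MeanRisk.deviate (MeanRisk.det û) (MeanRisk.det v) n) n x) '' K.detAdmissible) 0 ∧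
      û ∈ K.detAdmissible ∧
      MeanRisk.hjbTerm K ρ X (MeanRisk.det û) (MeanRisk.det û) n x = 0) ∧
    -- the terminal condition
    (∀ x, K.J ρ X (MeanRisk.det û) K.T x = K.rew 0 - K.lam K.T * K.F 0) ∧
    -- the generator of the reward term
    (∀ n < K.T, ∀ x,
      Integrable (fun ω =>
        K.rew (X n x (MeanRisk.det û) K.T ω
            - X n x (MeanRisk.det û) ((n + 1 : ℕ) : ℝ) ω * Real.exp (K.r * (K.T - n - 1)))
          - K.rew (X n x (MeanRisk.det û) K.T ω - x * Real.exp (K.r * (K.T - n)))) P ∧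
      MeanRisk.generator P X (MeanRisk.det û) (K.rewardFn P X (MeanRisk.det û)) n x =
        ∫ ω, (K.rew (X n x (MeanRisk.det û) K.T ω
            - X n x (MeanRisk.det û) ((n + 1 : ℕ) : ℝ) ω * Real.exp (K.r * (K.T - n - 1)))
          - K.rew (X n x (MeanRisk.det û) K.T ω - x * Real.exp (K.r * (K.T - n)))) ∂P) ∧
    -- the generator of the risk term
    (∀ n < K.T, ∀ x,
      MeanRisk.generator P X (MeanRisk.det û) (K.riskFn ρ X (MeanRisk.det û)) n x =
        K.lam ((n + 1 : ℕ) : ℝ) *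
            (K.F (K.riskFormula ρ ϱ û (n + 1)) - K.F (K.riskFormula ρ ϱ û n))
          - (K.lam n - K.lam ((n + 1 : ℕ) : ℝ)) * K.F (K.riskFormula ρ ϱ û n)) ∧
    -- its terminal value
    (∀ x, K.riskFn ρ X (MeanRisk.det û) K.T x = K.lam K.T * K.F 0) := by
  obtain ⟨Q, κ, hF⟩ := exists_isFactorization K hL hsetting hLs hLs_symm
  have hν : IsProbabilityMeasure (K.lhatLaw P L P' Ls) :=
    isProbabilityMeasure_lhatLaw K hL.measurable hLs.measurable
  set ν := K.lhatLaw P L P' Ls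
  have hûd : û ∈ K.detAdmissible := fun k => (hû.1 k).2 0
  have hXd : ∀ v ∈ K.detAdmissible, ∀ n ≤ K.T, ∀ x,
      K.IsWealth P L n x (det v) (X n x (det v)) := fun v hv n hn x =>
    hX n hn x _ (det_mem_admissible hv)
  have hcont : Continuous K.rew := K.rew_smooth.continuous
  have hint : ∀ v, ∀ n ≤ K.T, Integrable K.rew (gainLaw K ν v n) := fun v n hn =>
    hF.integrable_rew hL hrew v hn
  have hgain : ∀ v ∈ K.detAdmissible, ∀ n ≤ K.T, ∀ x,
      P.map (K.gain X (det v) n x) = gainLaw K ν v n := fun v hv n hn x =>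
    map_gain hF hL hv hn (hXd v hv n hn x)
  have hgm : ∀ v ∈ K.detAdmissible, ∀ n ≤ K.T, ∀ x, Measurable (K.gain X (det v) n x) :=
    fun v hv n hn x => measurable_gain hn (hXd v hv n hn x)
  have hgint : ∀ v ∈ K.detAdmissible, ∀ n ≤ K.T, ∀ x,
      Integrable (fun ω => K.rew (K.gain X (det v) n x ω)) P := by
    intro v hv n hn x
    have := hint v n hn
    rw [← hgain v hv n hn x] at this
    exact this.comp_measurable (hgm v hv n hn x)
  have hrisk : ∀ v ∈ K.detAdmissible, ∀ n ≤ K.T, ∀ x,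
      K.riskVal ρ X (det v) n x = (K.riskFormula ρ ϱ v n : EReal) := by
    intro v hv n hn x
    rw [Market.riskVal, hgain v hv n hn x, ofLaw_gainLaw ρ hϱ]
  have hG : ∀ v ∈ K.detAdmissible, ∀ n ≤ K.T, ∀ x,
      K.rewardFn P X (det v) n x = ∫ y, K.rew y ∂(gainLaw K ν v n) := by
    intro v hv n hn x
    rw [← hgain v hv n hn x, integral_map (hgm v hv n hn x).aemeasurable
      hcont.aestronglyMeasurable]
    rfl
  have hH : ∀ v ∈ K.detAdmissible, ∀ n ≤ K.T, ∀ x,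
      K.riskFn ρ X (det v) n x = K.lam n * K.F (K.riskFormula ρ ϱ v n) := by
    intro v hv n hn x
    rw [Market.riskFn, hrisk v hv n hn x, EReal.toReal_coe]
  have hdev : ∀ v ∈ K.detAdmissible, ∀ n, Function.update û n (v n) ∈ K.detAdmissible := by
    intro v hv n k
    by_cases h : k = n
    · subst h; simpa using hv k
    · simpa [h] using hûd k
  -- the deviation at time `n` is not visible from time `n + 1` on
  have hlater : ∀ (v : ℕ → Vec d) (n : ℕ), ∀ k, n + 1 ≤ k → Function.update û n (v n) k = û k :=
    fun v n k hk => Function.update_of_ne (by omega) _ _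
  have hgen : ∀ v ∈ K.detAdmissible, ∀ n < K.T, ∀ x,
      let u := deviate (det û) (det v) n
      GeneratorExists P X u (K.J ρ X (det û)) n x ∧
      GeneratorExists P X u (K.rewardFn P X u) n x ∧
      GeneratorExists P X u (K.riskFn ρ X u) n x ∧
      hjbTerm K ρ X (det û) u n x = K.J ρ X u n x - K.J ρ X (det û) n x := by
    intro v hv n hn x u
    have hu : u = det (Function.update û n (v n)) := deviate_det û v n
    have hw := hdev v hv n
    have h1 := generator_of_const (P := P) (X := X) (u := u) (f := K.J ρ X (det û)) (n := n)
      (c := (∫ y, K.rew y ∂(gainLaw K ν û (n + 1)))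
        - K.lam ((n + 1 : ℕ) : ℝ) * K.F (K.riskFormula ρ ϱ û (n + 1)))
      (fun y => by rw [Market.J, hG û hûd _ hn, hH û hûd _ hn]) x
    have h2 := generator_of_const (P := P) (X := X) (u := u) (f := K.rewardFn P X u) (n := n)
      (c := ∫ y, K.rew y ∂(gainLaw K ν û (n + 1)))
      (fun y => by
        rw [hu, hG _ hw _ hn, hF.gainLaw_congr hw hûd hn (hlater v n)]) x
    have h3 := generator_of_const (P := P) (X := X) (u := u) (f := K.riskFn ρ X u) (n := n)
      (c := K.lam ((n + 1 : ℕ) : ℝ) * K.F (K.riskFormula ρ ϱ û (n + 1)))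
      (fun y => by
        rw [hu, hH _ hw _ hn, hF.riskFormula_congr ρ hϱ hw hûd hn (hlater v n)]) x
    refine ⟨h1.1, h2.1, h3.1, ?_⟩
    rw [hjbTerm, h1.2, h2.2, h3.2, Market.J, Market.J]
    ring
  have hself : ∀ n, deviate (det û) (det û) n = det û := fun n => Function.update_eq_self _ _
  refine ⟨?_, ?_, ?_, ?_, ?_, ?_, ?_⟩
  · intro v hv n hn x
    refine ⟨hgint v hv n hn x, ?_, ?_⟩
    · rw [hrisk v hv n hn x]; exact EReal.coe_ne_top _
    · rw [hrisk v hv n hn x]; exact EReal.coe_ne_bot _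
  · intro v hv n hn x
    obtain ⟨h1, h2, h3, -⟩ := hgen v hv n hn x
    exact ⟨h1, h2, h3⟩
  · intro n hn x
    have hzero : hjbTerm K ρ X (det û) (det û) n x = 0 := by
      have := (hgen û hûd n hn x).2.2.2
      rwa [hself, sub_self] at this
    refine ⟨⟨?_, ?_⟩, hûd, hzero⟩
    · rintro _ ⟨v, hv, rfl⟩
      have h1 := (hgen v hv n hn x).2.2.2
      have h2 := (hû.2 n hn x).1 ⟨det v, det_mem_admissible hv, rfl⟩
      simp only at h1 h2 ⊢
      rw [h1]
      linarith
    · intro b hb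
      refine hb ⟨û, hûd, ?_⟩
      simp only
      rw [hself, hzero]
  · intro x
    rw [Market.J, hG û hûd _ le_rfl, hH û hûd _ le_rfl, gainLaw_horizon, riskFormula_horizon,
      integral_dirac]
  · intro n hn x
    have hXn := hXd û hûd n hn.le x
    have hn' : (n : ℝ) ≤ ((n + 1 : ℕ) : ℝ) := by push_cast; linarith
    have hnT : ((n + 1 : ℕ) : ℝ) ≤ K.T := by exact_mod_cast hn
    have hfun : (fun ω => X n x (det û) K.T ω
          - X n x (det û) ((n + 1 : ℕ) : ℝ) ω * Real.exp (K.r * (K.T - n - 1)))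
        = fun ω => X n x (det û) K.T ω
          - Real.exp (K.r * (K.T - (n + 1 : ℕ))) * X n x (det û) ((n + 1 : ℕ) : ℝ) ω := by
      funext ω
      push_cast
      rw [sub_sub, mul_comm]
    have hlaw : P.map (fun ω => X n x (det û) K.T ω
          - X n x (det û) ((n + 1 : ℕ) : ℝ) ω * Real.exp (K.r * (K.T - n - 1)))
        = gainLaw K ν û (n + 1) := by
      rw [hfun]
      exact hXn.map_gain hF hL hn (Nat.le_succ n) hn hûd
    have hmeas : Measurable fun ω => X n x (det û) K.T ω
          - X n x (det û) ((n + 1 : ℕ) : ℝ) ω * Real.exp (K.r * (K.T - n - 1)) :=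
      (hXn.measurable _ ⟨hn'.trans hnT, le_rfl⟩).sub ((hXn.measurable _ ⟨hn', hnT⟩).mul_const _)
    have hi1 : Integrable (fun ω => K.rew (X n x (det û) K.T ω
          - X n x (det û) ((n + 1 : ℕ) : ℝ) ω * Real.exp (K.r * (K.T - n - 1)))) P := by
      have := hint û (n + 1) hn
      rw [← hlaw] at this
      exact this.comp_measurable hmeas
    have hi2 := hgint û hûd n hn.le x
    simp only [Market.gain] at hi2
    refine ⟨hi1.sub hi2, ?_⟩
    have h2 := (generator_of_const (P := P) (X := X) (u := det û) (f := K.rewardFn P X (det û))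
      (n := n) (c := ∫ y, K.rew y ∂(gainLaw K ν û (n + 1)))
      (fun y => by rw [hG û hûd _ hn]) x).2
    rw [h2, integral_sub hi1 hi2, ← hlaw,
      integral_map hmeas.aemeasurable hcont.aestronglyMeasurable]
    rfl
  · intro n hn x
    rw [(generator_of_const (P := P) (X := X) (u := det û) (f := K.riskFn ρ X (det û))
      (n := n) (c := K.lam ((n + 1 : ℕ) : ℝ) * K.F (K.riskFormula ρ ϱ û (n + 1)))
      (fun y => by rw [hH û hûd _ hn]) x).2, hH û hûd _ hn.le]
    ring
  · intro x
    rw [hH û hûd _ le_rfl, riskFormula_horizon]
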